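/- Let $d\ge 2$ be an integer, let $\Bbbk$ be a field containing a primitive $d$-th root of unity $\zeta$, and put $S_1=\Bbbk[[x_1,\dots,x_a]]$, $S_2=\Bbbk[[y_1,\dots,y_b]]$, $S=\Bbbk[[x_1,\dots,x_a,y_1,\dots,y_b]]$. Let $f\in S_1$ and $g\in S_2$ be non-zero and non-invertible. For a commutative ring $Q$ and $h\in Q$, a matrix factorization of $h$ (with $d$ factors) is a $\mathbb Z/d$-graded $Q$-module $X=\bigoplus_{k\in\mathbb Z/d}X_k$ with finitely generated projective pieces, together with a $Q$-linear map $\phi:X\to X$ of degree $-1$ such that $\phi^d=h\cdot 1_X$. Morphisms are the degree $0$ linear maps commuting with the structure maps, and direct sums are formed degreewise; $X$ is indecomposable if it is non-zero and not isomorphic to a direct sum of two non-zero matrix factorizations of $h$. The shift $TX$ has pieces $(TX)_k=X_{k+1}$ and the same maps, re-indexed. If $Q$ is local with maximal ideal $\mathfrak n$, then $X$ is reduced if $\phi(X)\subseteq\mathfrak nX$. $X$ has rank $n$ if every $X_k$ has rank $n$. Let $(X,\phi)$ be an indecomposable reduced matrix factorization of $f$ over $S_1$, of rank $n$, and $(Y,\psi)$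 an indecomposable reduced matrix factorization of $g$ over $S_2$, of rank $m$, both with $d$ factors. Extend both to $S$, and let $X\,\widehat\otimes\,Y$ be the matrix factorization of $f+g$ over $S$ with $$(X\,\widehat\otimes\,Y)_k=\bigoplus_{i+j=k}X_i\otimes_S Y_j,\qquad \Phi(x\otimes y)=\phi(x)\otimes y+\zeta^{i}\,x\otimes\psi(y)\quad(x\in X_i,\ y\in Y_j).$$ Suppose that $X\not\cong T^iX$ and $Y\not\cong T^jY$ for all non-zero $i,j\in\mathbb Z/d$. Then $X\,\widehat\otimes\,Y$ is a direct sum of finitely many indecomposable matrix factorizations of $f+g$, and the number of summands (counted with multiplicity) in any such decomposition is at most $r=\gcd(n,m)$. -/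

import Mathlib

universe u

noncomputable section

open scoped TensorProduct

/-- For a family of modules `M k`, `k ∈ ℤ/d`, and maps `φ k : M (k + 1) → M k`, the induced
endomorphism of degree `-1` of the total module `⨁ k, M k` (written as a product, the index set
being finite for `d ≠ 0`). -/
def totalMap {Q : Type*} [CommRing Q] {d : ℕ} {M : ZMod d → Type*}
    [∀ k, AddCommGroup (M k)] [∀ k, Module Q (M k)] (φ : ∀ k, M (k + 1) →ₗ[Q] M k) :
    Module.End Q (∀ k, M k) :=
  LinearMap.pi fun k => (φ k).comp (LinearMap.proj (k + 1))

theorem totalMap_apply {Q : Type*} [CommRing Q] {d : ℕ} {M : ZMod d → Type*}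
    [∀ k, AddCommGroup (M k)] [∀ k, Module Q (M k)] (φ : ∀ k, M (k + 1) →ₗ[Q] M k)
    (x : ∀ k, M k) (k : ZMod d) : totalMap φ x k = φ k (x (k + 1)) := rfl

/-- A `d`-fold matrix factorization of `f ∈ Q`: a `ℤ/d`-graded module `⨁ k, obj k` whose
homogeneous pieces are finitely generated projective `Q`-modules, with an endomorphism of degree
`-1` whose `d`-th power is multiplication by `f`. The component `φ k : obj (k + 1) → obj k` is the
map usually denoted by `φ_{k+1}`. -/
structure MatFac (Q : Type u) [CommRing Q] (d : ℕ) (f : Q) where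
  obj : ZMod d → Type u
  [addCommGroup : ∀ k, AddCommGroup (obj k)]
  [module : ∀ k, Module Q (obj k)]
  [finite : ∀ k, Module.Finite Q (obj k)]
  [projective : ∀ k, Module.Projective Q (obj k)]
  φ : ∀ k, obj (k + 1) →ₗ[Q] obj k
  pow_eq : totalMap φ ^ d = f • (1 : Module.End Q (∀ k, obj k))

namespace MatFac

attribute [instance] MatFac.addCommGroup MatFac.module MatFac.finite MatFac.projective

/-- If a (semi)linear map intertwines two endomorphisms, it intertwines their powers. -/
theorem pow_intertwine {A B : Type*} (F : A → A) (G : B → B) (E : A → B)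
    (h : ∀ a, G (E a) = E (F a)) (n : ℕ) (a : A) : G^[n] (E a) = E (F^[n] a) := by
  induction n generalizing a with
  | zero => rfl
  | succ n ih => simp only [Function.iterate_succ, Function.comp, h, ih]

section Basic

variable {Q : Type u} [CommRing Q] {d : ℕ} {f : Q}

theorem iterate_eq (X : MatFac Q d f) (x : ∀ k, X.obj k) :
    (totalMap X.φ)^[d] x = f • x := by
  rw [← Module.End.coe_pow, X.pow_eq]; rfl

/-- Isomorphism of matrix factorizations: linear isomorphisms `obj k ≃ obj' k` for all `k ∈ ℤ/d`
commuting with the structure maps. -/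
def Isomorphic (X Y : MatFac Q d f) : Prop :=
  ∃ e : ∀ k, X.obj k ≃ₗ[Q] Y.obj k, ∀ k x, e k (X.φ k x) = Y.φ k (e (k + 1) x)

/-- The zero matrix factorizations. -/
def IsZero (X : MatFac Q d f) : Prop := ∀ k, Subsingleton (X.obj k)

/-- The shift `T X`, with `(T X)_k = X_{k+1}`. -/
def shift (X : MatFac Q d f) : MatFac Q d f where
  obj k := X.obj (k + 1)
  φ k := X.φ (k + 1)
  pow_eq := by
    refine LinearMap.ext fun w => ?_
    obtain ⟨u, rfl⟩ : ∃ u : ∀ k, X.obj k, (fun k => u (k + 1)) = w := by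
      refine ⟨(Equiv.piCongrLeft X.obj (Equiv.addRight (1 : ZMod d))) w, ?_⟩
      funext k
      exact Equiv.piCongrLeft_apply_apply X.obj (Equiv.addRight (1 : ZMod d)) w k
    rw [Module.End.coe_pow]
    have := pow_intertwine (totalMap X.φ) (totalMap fun k => X.φ (k + 1))
      (fun u k => u (k + 1)) (fun u => rfl) d u
    rw [this, X.iterate_eq]
    rfl

/-- The direct sum of two matrix factorizations. -/
def prod (X Y : MatFac Q d f) : MatFac Q d f where
  obj k := X.obj k × Y.obj k
  φ k := (X.φ k).prodMap (Y.φ k)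
  pow_eq := by
    refine LinearMap.ext fun w => ?_
    rw [Module.End.coe_pow]
    have := pow_intertwine (Prod.map (totalMap X.φ) (totalMap Y.φ))
      (totalMap fun k => (X.φ k).prodMap (Y.φ k))
      (fun u k => (u.1 k, u.2 k)) (fun u => rfl) d (fun k => (w k).1, fun k => (w k).2)
    refine this.trans ?_
    rw [Prod.map_iterate]
    simp only [Prod.map_apply, iterate_eq]
    rfl

/-- The direct sum of a finite family of matrix factorizations. -/
def directSum {ι : Type} [Finite ι] (Z : ι → MatFac Q d f) : MatFac Q d f where
  obj k := ∀ i, (Z i).obj k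
  projective k := by
    classical
    cases nonempty_fintype ι
    exact Module.Projective.of_equiv
      (DirectSum.linearEquivFunOnFintype Q ι fun i => (Z i).obj k)
  φ k := LinearMap.pi fun i => ((Z i).φ k).comp (LinearMap.proj i)
  pow_eq := by
    refine LinearMap.ext fun w => ?_
    funext k i
    rw [Module.End.coe_pow]
    have := pow_intertwine (totalMap fun k => LinearMap.pi fun i =>
      ((Z i).φ k).comp (LinearMap.proj (φ := fun i => (Z i).obj (k + 1)) i)) (totalMap (Z i).φ)
      (fun u k => (u k : ∀ i, (Z i).obj k) i) (fun u => rfl) d w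
    rw [iterate_eq] at this
    exact (congrFun this k).symm

/-- `X` is indecomposable: it is nonzero and is not a direct sum of two nonzero matrix
factorizations. -/
def Indecomposable (X : MatFac Q d f) : Prop :=
  ¬ X.IsZero ∧ ∀ A B : MatFac Q d f, X.Isomorphic (A.prod B) → A.IsZero ∨ B.IsZero

/-- `X` is isomorphic to a direct sum of `N` indecomposable matrix factorizations. -/
def IsSumOfIndecomposables (X : MatFac Q d f) (N : ℕ) : Prop :=
  ∃ Z : Fin N → MatFac Q d f, (∀ i, (Z i).Indecomposable) ∧ X.Isomorphic (directSum Z)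

/-- `X` has rank `n`: every homogeneous piece has rank `n`. -/
def HasRank (X : MatFac Q d f) (n : ℕ) : Prop := ∀ k, Module.finrank Q (X.obj k) = n

/-- A matrix factorization over a local ring `(Q, 𝔫)` is reduced if `Im φ_k ⊆ 𝔫 X_{k-1}` for
all `k`. -/
def IsReduced [IsLocalRing Q] (X : MatFac Q d f) : Prop :=
  ∀ k, LinearMap.range (X.φ k) ≤ IsLocalRing.maximalIdeal Q • (⊤ : Submodule Q (X.obj k))

end Basic

/-- Extension of scalars of a matrix factorization along a ring homomorphism. -/
def baseChange {Q Q' : Type u} [CommRing Q] [CommRing Q'] {d : ℕ} [NeZero d] {f : Q}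
    (ρ : Q →+* Q')
    (X : MatFac Q d f) : MatFac Q' d (ρ f) :=
  letI := ρ.toAlgebra
  { obj := fun k => Q' ⊗[Q] X.obj k
    φ := fun k => (X.φ k).baseChange Q'
    pow_eq := by
      refine LinearMap.pi_ext' fun k => TensorProduct.AlgebraTensorModule.ext fun s x => ?_
      have h1 : ∀ u : ∀ k, X.obj k, totalMap (fun k => (X.φ k).baseChange Q')
          (fun k => s ⊗ₜ[Q] u k) = fun k => s ⊗ₜ[Q] totalMap X.φ u k := fun u => rfl
      have h2 : (Pi.single k (s ⊗ₜ[Q] x) : ∀ k, Q' ⊗[Q] X.obj k) =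
          fun j => s ⊗ₜ[Q] (Pi.single k x : ∀ k, X.obj k) j := by
        funext j
        by_cases h : j = k
        · subst h; simp
        · simp [Pi.single_eq_of_ne h]
      simp only [LinearMap.comp_apply, LinearMap.single_apply]
      rw [Module.End.coe_pow, h2]
      refine (pow_intertwine (totalMap X.φ) _ (fun u j => s ⊗ₜ[Q] u j) h1 d _).trans ?_
      rw [X.iterate_eq]
      funext j
      simp only [Pi.smul_apply, LinearMap.smul_apply, Module.End.one_apply]
      rw [TensorProduct.tmul_smul, ← algebraMap_smul Q' f]
      rfl }

section Tensor

/-- Gaussian binomial coefficients. -/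
def gaussBinom {R : Type*} [CommRing R] (q : R) : ℕ → ℕ → R
  | _, 0 => 1
  | 0, _ + 1 => 0
  | n + 1, k + 1 => q ^ (k + 1) * gaussBinom q n (k + 1) + gaussBinom q n k

theorem gaussBinom_zero_right {R : Type*} [CommRing R] (q : R) (n : ℕ) :
    gaussBinom q n 0 = 1 := by cases n <;> rfl

theorem gaussBinom_of_lt {R : Type*} [CommRing R] (q : R) (n k : ℕ) (h : n < k) :
    gaussBinom q n k = 0 := by
  induction n generalizing k with
  | zero => cases k with
    | zero => omega
    | succ k => rfl
  | succ n ih => cases k with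
    | zero => omega
    | succ k => rw [gaussBinom, ih _ (by omega), ih _ (by omega)]; ring

theorem gaussBinom_self {R : Type*} [CommRing R] (q : R) (n : ℕ) :
    gaussBinom q n n = 1 := by
  induction n with
  | zero => rfl
  | succ n ih => rw [gaussBinom, gaussBinom_of_lt _ _ _ (by omega), ih]; ring

theorem gaussBinom_mul {R : Type*} [CommRing R] (q : R) (n k : ℕ) (h : k ≤ n) :
    gaussBinom q n (k + 1) * (q ^ (k + 1) - 1) = gaussBinom q n k * (q ^ (n - k) - 1) := by
  induction n generalizing k with
  | zero =>
    obtain rfl : k = 0 := by omega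
    simp [gaussBinom]
  | succ n ih =>
    have key : gaussBinom q (n + 1) (k + 1) * (q ^ (k + 1) - 1) =
        gaussBinom q n k * (q ^ (n + 1) - 1) := by
      rcases Nat.lt_or_ge n k with hk | hk
      · obtain rfl : k = n + 1 := by omega
        rw [gaussBinom_of_lt _ _ _ (by omega), gaussBinom_of_lt _ _ _ (by omega)]; ring
      · have e : q ^ (n + 1) = q ^ (k + 1) * q ^ (n - k) := by
          rw [← pow_add]; congr 1; omega
        rw [gaussBinom, e]
        linear_combination q ^ (k + 1) * ih k hk
    rw [key]
    cases k with
    | zero => simp [gaussBinom_zero_right]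
    | succ j =>
      have e : q ^ (n + 1) = q ^ (j + 1) * q ^ (n + 1 - (j + 1)) := by
        rw [← pow_add]; congr 1; omega
      have e' : n + 1 - (j + 1) = n - j := by omega
      have i := ih j (by omega)
      rw [gaussBinom, e, e']
      linear_combination i

theorem gaussBinom_eq_zero {R : Type*} [CommRing R] [IsDomain R] {q : R} {d : ℕ}
    (hq : IsPrimitiveRoot q d) (k : ℕ) (h : k + 1 < d) : gaussBinom q d (k + 1) = 0 := by
  have hk : q ^ (k + 1) - 1 ≠ 0 := sub_ne_zero.2 (hq.pow_ne_one_of_pos_of_lt (by omega) h)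
  have := gaussBinom_mul q d k (by omega)
  induction k with
  | zero =>
    rw [Nat.sub_zero, hq.pow_eq_one, sub_self, mul_zero] at this
    exact (mul_eq_zero.1 this).resolve_right hk
  | succ j ih =>
    have h0 := ih (by omega) (sub_ne_zero.2 (hq.pow_ne_one_of_pos_of_lt (by omega) (by omega)))
      (gaussBinom_mul q d j (by omega))
    rw [h0, zero_mul] at this
    exact (mul_eq_zero.1 this).resolve_right hk

theorem map_gaussBinom {R S : Type*} [CommRing R] [CommRing S] (ρ : R →+* S) (q : R) (n k : ℕ) :
    ρ (gaussBinom q n k) = gaussBinom (ρ q) n k := by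
  induction n generalizing k with
  | zero => cases k <;> simp [gaussBinom]
  | succ n ih => cases k <;> simp [gaussBinom, ih]

/-- The noncommutative binomial theorem for `A B = q B A`. -/
theorem add_pow_of_gauss {R E : Type*} [CommRing R] [Ring E] [Algebra R E] (q : R) (A B : E)
    (h : A * B = q • (B * A)) (n : ℕ) :
    (A + B) ^ n = ∑ k ∈ Finset.range (n + 1), gaussBinom q n k • (B ^ k * A ^ (n - k)) := by
  have hk : ∀ k : ℕ, A * B ^ k = q ^ k • (B ^ k * A) := by
    intro k
    induction k with
    | zero => simp
    | succ k ih =>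
      rw [pow_succ, ← mul_assoc, ih, smul_mul_assoc, mul_assoc, h, mul_smul_comm, smul_smul,
        ← mul_assoc, pow_succ]
  induction n with
  | zero => simp [gaussBinom]
  | succ n ih =>
    rw [pow_succ', ih, Finset.mul_sum, Finset.sum_range_succ' _ (n + 1)]
    have h1 : ∀ k ∈ Finset.range (n + 1),
        (A + B) * gaussBinom q n k • (B ^ k * A ^ (n - k)) =
        (q ^ k * gaussBinom q n k) • (B ^ k * A ^ (n + 1 - k)) +
          gaussBinom q n k • (B ^ (k + 1) * A ^ (n + 1 - (k + 1))) := by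
      intro k hk'
      have : n + 1 - k = (n - k) + 1 := by have := Finset.mem_range.1 hk'; omega
      rw [this, Nat.add_sub_add_right, mul_smul_comm, add_mul, ← mul_assoc, hk, smul_add,
        smul_mul_assoc, smul_smul, mul_assoc, ← pow_succ', mul_comm, ← mul_assoc, ← pow_succ']
    rw [Finset.sum_congr rfl h1, Finset.sum_add_distrib]
    have h2 : ∑ k ∈ Finset.range (n + 1),
        (q ^ k * gaussBinom q n k) • (B ^ k * A ^ (n + 1 - k)) =
        ∑ k ∈ Finset.range (n + 1),
          (q ^ (k + 1) * gaussBinom q n (k + 1)) • (B ^ (k + 1) * A ^ (n + 1 - (k + 1))) +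
          A ^ (n + 1) := by
      rw [Finset.sum_range_succ' _ n, Finset.sum_range_succ _ n,
        gaussBinom_of_lt q n (n + 1) (by omega)]
      simp [gaussBinom_zero_right]
    rw [h2]
    simp only [gaussBinom, add_smul, Finset.sum_add_distrib]
    simp only [pow_zero, one_mul, one_smul, Nat.sub_zero]
    abel

theorem add_pow_of_primitiveRoot {R Q E : Type*} [CommRing R] [IsDomain R] [CommRing Q] [Algebra R Q]
    [Ring E] [Algebra Q E] {q : R} {d : ℕ} [NeZero d] (hq : IsPrimitiveRoot q d) (A B : E)
    (h : A * B = algebraMap R Q q • (B * A)) : (A + B) ^ d = A ^ d + B ^ d := by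
  rw [add_pow_of_gauss (algebraMap R Q q) A B h d, Finset.sum_range_succ, gaussBinom_self]
  have : ∑ k ∈ Finset.range d,
      gaussBinom (algebraMap R Q q) d k • (B ^ k * A ^ (d - k)) = A ^ d := by
    rw [Finset.sum_eq_single_of_mem 0 (Finset.mem_range.2 (NeZero.pos d))]
    · simp [gaussBinom_zero_right]
    · intro k hk hk0
      obtain ⟨j, rfl⟩ := Nat.exists_eq_succ_of_ne_zero hk0
      rw [← map_gaussBinom, gaussBinom_eq_zero hq j (Finset.mem_range.1 hk), map_zero, zero_smul]
  rw [this]; simp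

variable {R : Type*} [CommRing R] {Q : Type u} [CommRing Q] [Algebra R Q] {d : ℕ}
  {f g : Q}

/-- The degree `k` piece `⨁_{i + j = k} X_i ⊗ Y_j` of the tensor product. -/
abbrev TensorObj (X : MatFac Q d f) (Y : MatFac Q d g) (k : ZMod d) : Type u :=
  ∀ p : {p : ZMod d × ZMod d // p.1 + p.2 = k}, X.obj p.1.1 ⊗[Q] Y.obj p.1.2

/-- The map `x ⊗ y ↦ φ(x) ⊗ y`. -/
def tensorLeft (X : MatFac Q d f) (Y : MatFac Q d g) (k : ZMod d) :
    TensorObj X Y (k + 1) →ₗ[Q] TensorObj X Y k :=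
  LinearMap.pi fun p => ((X.φ p.1.1).rTensor (Y.obj p.1.2)).comp
    (LinearMap.proj (φ := fun p : {p : ZMod d × ZMod d // p.1 + p.2 = k + 1} =>
      X.obj p.1.1 ⊗[Q] Y.obj p.1.2)
      ⟨(p.1.1 + 1, p.1.2), by rw [add_right_comm, p.2]⟩)

/-- The map `x ⊗ y ↦ ζ^{|x|} x ⊗ ψ(y)`. -/
def tensorRight (ζ : R) (X : MatFac Q d f) (Y : MatFac Q d g) (k : ZMod d) :
    TensorObj X Y (k + 1) →ₗ[Q] TensorObj X Y k :=
  LinearMap.pi fun p => algebraMap R Q (ζ ^ p.1.1.val) •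
    ((Y.φ p.1.2).lTensor (X.obj p.1.1)).comp
      (LinearMap.proj (φ := fun p : {p : ZMod d × ZMod d // p.1 + p.2 = k + 1} =>
        X.obj p.1.1 ⊗[Q] Y.obj p.1.2)
        ⟨(p.1.1, p.1.2 + 1), by rw [← add_assoc, p.2]⟩)

/-- The element of the total module of the tensor product given by a pair of elements of the
total modules of the factors. -/
def tensorElt {X : MatFac Q d f} {Y : MatFac Q d g} (u : ∀ k, X.obj k) (v : ∀ k, Y.obj k)
    (k : ZMod d) : TensorObj X Y k := fun p => u p.1.1 ⊗ₜ[Q] v p.1.2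

theorem tensor_ext {X : MatFac Q d f} {Y : MatFac Q d g} [NeZero d]
    {F G : Module.End Q (∀ k, TensorObj X Y k)}
    (h : ∀ u v, F (tensorElt u v) = G (tensorElt u v)) : F = G := by
  refine LinearMap.pi_ext' fun k => LinearMap.pi_ext' fun p => TensorProduct.ext' fun x y => ?_
  have e : (Pi.single k (Pi.single p (x ⊗ₜ[Q] y)) : ∀ k, TensorObj X Y k) =
      tensorElt (Pi.single p.1.1 x) (Pi.single p.1.2 y) := by
    obtain ⟨⟨i, j⟩, rfl⟩ := p
    funext k' p'
    obtain ⟨⟨i', j'⟩, rfl⟩ := p'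
    dsimp only [tensorElt]
    by_cases hi : i' = i
    · subst hi
      by_cases hj : j' = j
      · subst hj; simp
      · have : i' + j' ≠ i' + j := fun h => hj (add_left_cancel h)
        rw [Pi.single_eq_of_ne this, Pi.single_eq_of_ne hj]; simp
    · rw [Pi.single_eq_of_ne hi, TensorProduct.zero_tmul]
      by_cases hk : i' + j' = i + j
      · generalize hz : Pi.single (M := fun p : {p : ZMod d × ZMod d // p.1 + p.2 = i + j} =>
          X.obj p.1.1 ⊗[Q] Y.obj p.1.2) ⟨(i, j), rfl⟩ (x ⊗ₜ[Q] y) = z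
        have hz' : z ⟨(i', j'), hk⟩ = 0 := by
          rw [← hz]; exact Pi.single_eq_of_ne (by simp [hi]) _
        have : ∀ (k'' : ZMod d) (hk'' : i' + j' = k'') (k₀ : ZMod d) (z : TensorObj X Y k₀)
            (hk₀ : i' + j' = k₀), z ⟨(i', j'), hk₀⟩ = 0 →
            (Pi.single k₀ z : ∀ k, TensorObj X Y k) k'' ⟨(i', j'), hk''⟩ = 0 := by
          intro k'' hk'' k₀ z hk₀ h0
          subst hk'' hk₀
          simpa using h0
        exact this _ rfl _ z hk hz'
      · rw [Pi.single_eq_of_ne hk]; rfl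
  simp only [LinearMap.comp_apply, LinearMap.single_apply]
  rw [e]
  exact h _ _

theorem zeta_pow_val_add_one [NeZero d] {ζ : R} (hζ : ζ ^ d = 1) (i : ZMod d) :
    ζ ^ (i + 1).val = ζ * ζ ^ i.val := by
  have h : ∀ n : ℕ, ζ ^ (n % d) = ζ ^ n := fun n => by
    conv_rhs => rw [← Nat.mod_add_div n d, pow_add, pow_mul, hζ, one_pow, mul_one]
  rw [ZMod.val_add, h, pow_add, mul_comm, ZMod.val_one_eq_one_mod, h, pow_one]

/-- The tensor product of matrix factorizations of `f` and `g`, formed with a primitive `d`-th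
root of unity `ζ`: the graded module with `k`-th piece `⨁_{i + j = k} X_i ⊗ Y_j` and with the map
`x ⊗ y ↦ φ(x) ⊗ y + ζ^{|x|} x ⊗ ψ(y)`. -/
def tensor [IsDomain R] [NeZero d] (ζ : R) (hζ : IsPrimitiveRoot ζ d)
    (X : MatFac Q d f) (Y : MatFac Q d g) : MatFac Q d (f + g) where
  obj k := TensorObj X Y k
  projective k := by
    classical
    exact Module.Projective.of_equiv (DirectSum.linearEquivFunOnFintype Q
      {p : ZMod d × ZMod d // p.1 + p.2 = k} fun p => X.obj p.1.1 ⊗[Q] Y.obj p.1.2)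
  φ k := tensorLeft X Y k + tensorRight ζ X Y k
  pow_eq := by
    have hA : ∀ u v, totalMap (tensorLeft X Y) (tensorElt u v) =
        tensorElt (totalMap X.φ u) v := fun u v => rfl
    have hB : ∀ u v, totalMap (tensorRight ζ X Y) (tensorElt u v) =
        tensorElt (fun i => algebraMap R Q (ζ ^ i.val) • u i) (totalMap Y.φ v) := by
      intro u v
      funext k p
      exact TensorProduct.smul_tmul' _ _ _
    have hsum : totalMap (fun k => tensorLeft X Y k + tensorRight ζ X Y k) =
        totalMap (tensorLeft X Y) + totalMap (tensorRight ζ X Y) := rfl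
    have hcomm : totalMap (tensorLeft X Y) * totalMap (tensorRight ζ X Y) =
        algebraMap R Q ζ • (totalMap (tensorRight ζ X Y) * totalMap (tensorLeft X Y)) := by
      refine tensor_ext fun u v => ?_
      simp only [Module.End.mul_apply, LinearMap.smul_apply, hA, hB]
      funext k p
      simp only [Pi.smul_apply, tensorElt, totalMap_apply, map_smul,
        zeta_pow_val_add_one hζ.pow_eq_one, map_mul, mul_smul, TensorProduct.smul_tmul']
    have hpowA : totalMap (tensorLeft X Y) ^ d = f • 1 := by
      refine tensor_ext fun u v => ?_
      rw [Module.End.coe_pow, pow_intertwine (totalMap X.φ) (totalMap (tensorLeft X Y))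
        (fun u => tensorElt u v) (fun u => hA u v), X.iterate_eq]
      funext k p
      exact (TensorProduct.smul_tmul' _ _ _).symm
    have hpowB : totalMap (tensorRight ζ X Y) ^ d = g • 1 := by
      refine tensor_ext fun u v => ?_
      have := pow_intertwine (A := (∀ k, X.obj k) × (∀ k, Y.obj k))
        (fun w => (fun i => algebraMap R Q (ζ ^ i.val) • w.1 i, totalMap Y.φ w.2))
        (totalMap (tensorRight ζ X Y)) (fun w => tensorElt w.1 w.2) (fun w => hB w.1 w.2)
        d (u, v)
      rw [Module.End.coe_pow]
      refine this.trans ?_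
      have hit : ∀ n : ℕ, (fun w : (∀ k, X.obj k) × (∀ k, Y.obj k) =>
          ((fun i => algebraMap R Q (ζ ^ i.val) • w.1 i, totalMap Y.φ w.2) :
            (∀ k, X.obj k) × (∀ k, Y.obj k)))^[n] (u, v) =
          (fun i => algebraMap R Q ((ζ ^ n) ^ i.val) • u i, (totalMap Y.φ)^[n] v) := by
        intro n
        induction n with
        | zero => simp
        | succ n ih =>
          rw [Function.iterate_succ_apply', ih, Function.iterate_succ_apply']
          refine Prod.ext (funext fun i => ?_) rfl
          simp only [smul_smul, ← map_mul, ← mul_pow, pow_succ']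
      rw [hit, hζ.pow_eq_one, Y.iterate_eq]
      funext k p
      simp [tensorElt]
    rw [hsum, add_pow_of_primitiveRoot hζ _ _ hcomm, hpowA, hpowB, add_smul]

/-- For `X` over `𝕜⟦x₁, …, x_a⟧` and `Y` over `𝕜⟦y₁, …, y_b⟧`, the tensor product of the extensions
of `X` and `Y` to `𝕜⟦x₁, …, x_a, y₁, …, y_b⟧`, a matrix factorization of `f(x) + g(y)`. -/
def externalTensor {𝕜 : Type u} [Field 𝕜] {d : ℕ} [NeZero d] (ζ : 𝕜) (hζ : IsPrimitiveRoot ζ d)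
    {a b : ℕ} {f : MvPowerSeries (Fin a) 𝕜} {g : MvPowerSeries (Fin b) 𝕜}
    (X : MatFac (MvPowerSeries (Fin a) 𝕜) d f) (Y : MatFac (MvPowerSeries (Fin b) 𝕜) d g) :
    MatFac (MvPowerSeries (Fin a ⊕ Fin b) 𝕜) d
      (MvPowerSeries.rename (R := 𝕜) (Sum.inl : Fin a → Fin a ⊕ Fin b) f +
        MvPowerSeries.rename (R := 𝕜) (Sum.inr : Fin b → Fin a ⊕ Fin b) g) :=
  tensor ζ hζ
    (X.baseChange (MvPowerSeries.rename (R := 𝕜) (Sum.inl : Fin a → Fin a ⊕ Fin b)).toRingHom)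
    (Y.baseChange (MvPowerSeries.rename (R := 𝕜) (Sum.inr : Fin b → Fin a ⊕ Fin b)).toRingHom)

end Tensor

end MatFac

end

/-!
Write `X ⊗ Y` for the tensor product over `𝕜⟦x, y⟧`, and describe a matrix factorization by the
matrix of its structure map on the total module `⨁ i, X i`, together with the grading operator,
which acts on degree `i` as `ζ ^ i`: commuting with the grading operator means preserving degrees
(`gradMatrix`, `MatFac.totalMatrix`). The structure map of `X ⊗ Y` is `A ⊗ 1 + ζ ^ i ⊗ B`, where `A`
and `B` belong to `X` and `Y`, and a decomposition into `N` nonzero summands amounts to `N` nonzero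
orthogonal idempotent matrices `E l` commuting with it and with the grading.

Since `X` and `Y` are reduced, setting the variables `y` to zero kills `B` and leaves `A ⊗ 1`: over
`𝕜⟦x⟧` the tensor product becomes a direct sum of shifts of `X`, the `j`-th shift occurring `m`
times. As `𝕜⟦x⟧` is complete, `X` has a local endomorphism ring
(`MatFac.Indecomposable.isRigidLocal`), so the Krull-Schmidt theorem applies: the image of the
idempotent `E l` contains the `j`-th shift of `X` with a multiplicity `a l j`, and `∑ l, a l j ≤ m`.
Likewise, setting the variables `x` to zero leaves `ζ ^ i ⊗ B`, which the diagonal change of basis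
by `ζ ^ (i j)` on `X i ⊗ Y j` turns into `1 ⊗ B` (`twistSwap_gradMatrix_kronecker`); this gives
multiplicities `b l i` of the shifts of `Y`.

Both multiplicities can be read off over the residue field, from the block of `E l` on `X i ⊗ Y j`.
This block need not be idempotent, because `E l` preserves only the total degree. But `X` is not
isomorphic to its proper shifts, so that modulo the radical of the endomorphism ring of `X` the
passage through other degrees contributes nothing (`degreeSlices_mul_map`): the block is an
idempotent up to nilpotents, and its high powers have rank `n * a l j` (`rank_matrixRep_pow`,
`IsRigidLocal.exists_multiplicities`). Seen from the other side, the same rank is `m * b l i`. Hence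
`n * a l j = m * b l i` for all `i` and `j`, so `n * a l j` does not depend on `j`, is divisible by
`lcm n m`, and is not zero, since an idempotent all of whose multiplicities vanish lies in the
radical. Summing `lcm n m ≤ n * a l j` over `l` gives `N * lcm n m ≤ n * m`, that is, `N ≤ gcd n m`
(`card_le_gcd`, `card_le_gcd_of_orthogonal_idempotents`).
-/

open scoped TensorProduct

section

open Matrix Polynomial

/-! ### Power series without constant term -/

/-- A power series in finitely many variables without constant term lies in the ideal generated by
the variables: sort its monomials by the least variable that divides them. -/
theorem MvPowerSeries.mem_span_range_X_of_constantCoeff_eq_zero {k : Type*} [CommRing k] {a : ℕ}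
    (F : MvPowerSeries (Fin a) k) (hF : MvPowerSeries.constantCoeff F = 0) :
    F ∈ Ideal.span (Set.range (MvPowerSeries.X : Fin a → MvPowerSeries (Fin a) k)) := by
  classical
  let P : Fin a → MvPowerSeries (Fin a) k := fun i μ =>
    if μ i ≠ 0 ∧ ∀ j < i, μ j = 0 then MvPowerSeries.coeff μ F else 0
  have hP : ∀ i μ, MvPowerSeries.coeff μ (P i) =
      if μ i ≠ 0 ∧ ∀ j < i, μ j = 0 then MvPowerSeries.coeff μ F else 0 := fun _ _ => rfl
  have hsum : F = ∑ i, P i := by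
    ext μ
    rw [map_sum]
    simp only [hP]
    by_cases hμ : μ = 0
    · subst hμ
      simpa using hF
    · have hex : ∃ i, μ i ≠ 0 := by
        by_contra! h
        exact hμ (Finsupp.ext h)
      obtain ⟨i, hi, hmin⟩ := WellFounded.has_min (wellFounded_lt (α := Fin a))
        {i | μ i ≠ 0} hex
      have hmin' : ∀ j < i, μ j = 0 := fun j hj => by
        by_contra h
        exact hmin j h hj
      rw [Finset.sum_eq_single i, if_pos ⟨hi, hmin'⟩]
      · intro j _ hj
        rw [if_neg]
        rintro ⟨h1, h2⟩
        rcases lt_trichotomy j i with h | h | h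
        · exact h1 (hmin' j h)
        · exact hj h
        · exact hi (h2 i h)
      · simp
  rw [hsum]
  refine Ideal.sum_mem _ fun i _ => ?_
  obtain ⟨G, hG⟩ : MvPowerSeries.X i ∣ P i := by
    rw [MvPowerSeries.X_dvd_iff]
    intro μ hμ
    rw [hP, if_neg]
    simp [hμ]
  rw [hG]
  exact Ideal.mul_mem_right _ _ (Ideal.subset_span ⟨i, rfl⟩)

/-! ### Lifting idempotent matrices -/

section Lift

variable {R : Type*} [CommRing R] {Ω : Type*} [Fintype Ω]

theorem mul_entries_mem {I J : Ideal R} {M N : Matrix Ω Ω R} (hM : ∀ x y, M x y ∈ I)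
    (hN : ∀ x y, N x y ∈ J) (x y : Ω) : (M * N) x y ∈ I * J :=
  Ideal.sum_mem _ fun z _ => Ideal.mul_mem_mul (hM x z) (hN z y)

theorem mul_entries_mem_left {I : Ideal R} {M : Matrix Ω Ω R} (hM : ∀ x y, M x y ∈ I)
    (N : Matrix Ω Ω R) (x y : Ω) : (M * N) x y ∈ I :=
  Ideal.sum_mem _ fun z _ => Ideal.mul_mem_right _ _ (hM x z)

theorem mul_entries_mem_right {I : Ideal R} {N : Matrix Ω Ω R} (M : Matrix Ω Ω R)
    (hN : ∀ x y, N x y ∈ I) (x y : Ω) : (M * N) x y ∈ I :=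
  Ideal.sum_mem _ fun z _ => Ideal.mul_mem_left _ _ (hN z y)

variable [DecidableEq Ω]

/-- Over an `I`-adically complete ring, a matrix which is idempotent modulo `I` is congruent modulo
`I` to an idempotent matrix that commutes with everything it commutes with: the limit of the Newton
iteration `e ↦ 3 e² - 2 e³`. -/
theorem exists_isIdempotentElem_matrix (I : Ideal R) [IsAdicComplete I R] (e₀ : Matrix Ω Ω R)
    (h₀ : ∀ x y, (e₀ * e₀ - e₀) x y ∈ I) :
    ∃ e : Matrix Ω Ω R, IsIdempotentElem e ∧ (∀ x y, (e - e₀) x y ∈ I) ∧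
      ∀ M, Commute M e₀ → Commute M e := by
  let F : Matrix Ω Ω R → Matrix Ω Ω R := fun e => 3 * (e * e) - 2 * (e * e * e)
  let s : ℕ → Matrix Ω Ω R := fun n => F^[n] e₀
  have hs : ∀ n, s (n + 1) = F (s n) := fun n => Function.iterate_succ_apply' F n e₀
  have hv : ∀ n x y, (s n * s n - s n) x y ∈ I ^ (n + 1) := by
    intro n
    induction n with
    | zero =>
      intro x y
      rw [zero_add, pow_one]
      exact h₀ x y
    | succ n ih =>
      have key : s (n + 1) * s (n + 1) - s (n + 1) =
          (s n * s n - s n) * (s n * s n - s n) * (4 * (s n * s n - s n) - 3) := by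
        rw [hs]
        simp only [F]
        noncomm_ring
      intro x y
      rw [key]
      refine mul_entries_mem_left (fun x y => ?_) _ x y
      have := mul_entries_mem ih ih x y
      rw [← pow_add] at this
      exact Ideal.pow_le_pow_right (by omega) this
  have hd : ∀ n x y, (s (n + 1) - s n) x y ∈ I ^ (n + 1) := by
    intro n x y
    have key : s (n + 1) - s n = (1 - 2 * s n) * (s n * s n - s n) := by
      rw [hs]
      simp only [F]
      noncomm_ring
    rw [key]
    exact mul_entries_mem_right _ (hv n) x y
  have hd' : ∀ n m, n ≤ m → ∀ x y, (s n - s m) x y ∈ I ^ (n + 1) := by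
    intro n m hnm x y
    induction m, hnm using Nat.le_induction with
    | base => simp
    | succ m hm ih =>
      have h2 := Ideal.pow_le_pow_right (I := I) (show n + 1 ≤ m + 1 by omega) (hd m x y)
      have : (s n - s (m + 1)) x y = (s n - s m) x y - (s (m + 1) - s m) x y := by
        simp only [Matrix.sub_apply]; ring
      rw [this]
      exact Ideal.sub_mem _ ih h2
  have hlim : ∀ x y, ∃ L : R, ∀ n, s n x y ≡ L [SMOD (I ^ n • ⊤ : Submodule R R)] := by
    intro x y
    refine IsPrecomplete.prec' (I := I) (fun n => s n x y) fun {n m} h => ?_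
    rw [SModEq.sub_mem]
    simpa using Ideal.pow_le_pow_right (show n ≤ n + 1 by omega) (hd' n m h x y)
  choose e he using hlim
  have he' : ∀ n x y, (s n - Matrix.of e) x y ∈ I ^ n := by
    intro n x y
    have := he x y n
    rw [SModEq.sub_mem] at this
    simpa using this
  have hzero : ∀ M : Matrix Ω Ω R, (∀ n x y, M x y ∈ I ^ n) → M = 0 := by
    intro M hM
    ext x y
    refine IsHausdorff.haus (inferInstance : IsHausdorff I R) _ fun n => ?_
    rw [SModEq.sub_mem]
    simpa using hM n x y
  refine ⟨Matrix.of e, ?_, ?_, ?_⟩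
  · refine sub_eq_zero.1 (hzero _ fun n x y => ?_)
    have key : Matrix.of e * Matrix.of e - Matrix.of e =
        (s n * s n - s n) - (s n - Matrix.of e) * s n - Matrix.of e * (s n - Matrix.of e)
          + (s n - Matrix.of e) := by noncomm_ring
    rw [key]
    refine Ideal.add_mem _ (Ideal.sub_mem _ (Ideal.sub_mem _ ?_ ?_) ?_) (he' n x y)
    · exact Ideal.pow_le_pow_right (by omega) (hv n x y)
    · exact mul_entries_mem_left (he' n) _ x y
    · exact mul_entries_mem_right _ (he' n) x y
  · intro x y
    have h1 : (Matrix.of e - e₀) x y = -((s 1 - Matrix.of e) x y) - (e₀ - s 1) x y := by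
      simp only [Matrix.sub_apply]; ring
    rw [h1]
    have h2 := he' 1 x y
    have h3 := hd' 0 1 (by omega) x y
    rw [pow_one] at h2
    rw [zero_add, pow_one] at h3
    exact Ideal.sub_mem _ (neg_mem h2) h3
  · intro M hM
    have hMs : ∀ n, Commute M (s n) := by
      intro n
      induction n with
      | zero => exact hM
      | succ n ih =>
        rw [hs]
        exact ((Commute.ofNat_right M 3).mul_right (ih.mul_right ih)).sub_right
          ((Commute.ofNat_right M 2).mul_right ((ih.mul_right ih).mul_right ih))
    refine sub_eq_zero.1 (hzero _ fun n x y => ?_)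
    have key : M * Matrix.of e - Matrix.of e * M =
        (s n - Matrix.of e) * M - M * (s n - Matrix.of e) := by
      have := (hMs n).eq
      rw [sub_mul, mul_sub, this]
      abel
    rw [key]
    exact Ideal.sub_mem _ (mul_entries_mem_left (he' n) _ x y)
      (mul_entries_mem_right _ (he' n) x y)

end Lift

/-! ### Matrix algebras with only trivial idempotents -/

section Local

variable {k : Type*} [Field k] {R : Type*} [CommRing R] [Algebra k R] (ε : R →ₐ[k] k)
  [IsLocalHom ε] {Ω : Type*} [Fintype Ω] [DecidableEq Ω]

theorem isUnit_of_isUnit_map (u : Matrix Ω Ω R) (h : IsUnit (ε.mapMatrix u)) : IsUnit u := by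
  rw [Matrix.isUnit_iff_isUnit_det] at h ⊢
  rw [← AlgHom.map_det] at h
  exact isUnit_of_map_unit ε _ h

/-- Fitting's lemma over a complete local ring: if every idempotent matrix that commutes with all
matrices commuting with `u` is trivial, then `u` or `1 - u` is invertible. The idempotent used lifts
the projection onto the part of the reduction of `u` where it is invertible. -/
theorem isUnit_or_isUnit_one_sub_of_trivial_idempotents (I : Ideal R) [IsAdicComplete I R]
    (hI : ∀ r, ε r = 0 ↔ r ∈ I) (u : Matrix Ω Ω R)
    (hid : ∀ e : Matrix Ω Ω R, IsIdempotentElem e → (∀ M, Commute M u → Commute M e) →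
      e = 0 ∨ e = 1) : IsUnit u ∨ IsUnit (1 - u) := by
  set v := ε.mapMatrix u with hv
  obtain ⟨r, hr, hXr⟩ := Polynomial.exists_eq_pow_rootMultiplicity_mul_and_not_dvd v.charpoly
    v.charpoly_monic.ne_zero 0
  set a := v.charpoly.rootMultiplicity 0
  rw [map_zero, sub_zero] at hr hXr
  have hcop : IsCoprime (X : k[X]) r :=
    (Irreducible.coprime_iff_not_dvd Polynomial.irreducible_X).2 hXr
  obtain ⟨α, β, hαβ⟩ := hcop.pow_left (m := a)
  have hχ : aeval v (X ^ a : k[X]) * aeval v r = 0 := by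
    rw [← map_mul, ← hr, Matrix.aeval_self_charpoly]
  set q := α * X ^ a with hq
  have hmap : ∀ p : k[X], ε.mapMatrix (aeval u p) = aeval v p := fun p =>
    (Polynomial.aeval_algHom_apply ε.mapMatrix u p).symm
  have h0 : aeval v q * aeval v q - aeval v q = 0 := by
    have : q * q - q = -(α * β) * (X ^ a * r) := by
      rw [hq]; linear_combination (α * X ^ a) * hαβ
    rw [← map_mul, ← map_sub, this, map_mul, map_mul, hχ, mul_zero]
  obtain ⟨e, he, hee, hcomm⟩ := exists_isIdempotentElem_matrix I (aeval u q) (fun x y => by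
    rw [← hI]
    have := congrFun (congrFun (show ε.mapMatrix (aeval u q * aeval u q - aeval u q) = 0 by
      rw [map_sub, map_mul, hmap, h0]) x) y
    exact this)
  have hev : ε.mapMatrix e = aeval v q := by
    rw [← hmap, ← sub_eq_zero, ← map_sub]
    ext x y
    exact (hI _).2 (hee x y)
  have hcommq : ∀ M, Commute M u → Commute M (aeval u q) := fun M hM => by
    induction q using Polynomial.induction_on' with
    | add p p' hp hp' => rw [map_add]; exact hp.add_right hp'
    | monomial n c =>
      rw [aeval_monomial]
      exact Commute.mul_right (Algebra.commutes c M).symm (hM.pow_right n)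
  rcases hid e he (fun M hM => hcomm M (hcommq M hM)) with h | h
  · -- The reduction of `u` is nilpotent.
    right
    rw [h, map_zero] at hev
    refine isUnit_of_isUnit_map ε _ ?_
    rw [map_sub, map_one, ← hv]
    have h1 : v ^ a = 0 := by
      have h2 : (X : k[X]) ^ a = X ^ a * q + β * (X ^ a * r) := by
        rw [hq]; linear_combination (-X ^ a) * hαβ
      have h3 := congrArg (aeval v) h2
      rwa [map_add, map_mul (aeval v) (X ^ a) q, ← hev, mul_zero, zero_add, map_mul,
        map_mul (aeval v) (X ^ a) r, hχ, mul_zero, map_pow, aeval_X] at h3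
    exact IsNilpotent.isUnit_one_sub ⟨a, h1⟩
  · left
    rw [h, map_one] at hev
    refine isUnit_of_isUnit_map ε _ ?_
    rw [← hv]
    obtain ⟨γ, δ, hγδ⟩ := hcop
    have h1 : aeval v r = 0 := by
      have : aeval v (q * r) = 0 := by
        rw [hq, mul_assoc, map_mul, map_mul _ _ r, hχ, mul_zero]
      rwa [map_mul, ← hev, one_mul] at this
    have h2 := congrArg (aeval v) hγδ
    rw [map_add, map_mul, map_mul, h1, mul_zero, add_zero, aeval_X, map_one] at h2
    exact IsUnit.of_mul_eq_one_right _ h2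

end Local

/-! ### Ranks of matrices over a division ring -/

section DivisionRing

variable {D : Type*} [DivisionRing D] {κ : Type*} [Fintype κ]

/-- The rank of a square matrix over a (not necessarily commutative) division ring: the dimension of
its row space. -/
noncomputable def rowRank (M : Matrix κ κ D) : ℕ :=
  Module.finrank D (LinearMap.range M.vecMulLinear)

theorem rowRank_ne_zero {M : Matrix κ κ D} (hM : M ≠ 0) : rowRank M ≠ 0 := by
  classical
  intro h
  apply hM
  have h1 : LinearMap.range M.vecMulLinear = ⊥ := Submodule.finrank_eq_zero.1 h
  rw [LinearMap.range_eq_bot] at h1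
  ext i j
  have := congrFun (LinearMap.congr_fun h1 (Pi.single i 1)) j
  simpa using this

/-- A matrix of rank `r` has an invertible `r × r` compression. -/
theorem exists_mul_mul_eq_one [DecidableEq κ] (M : Matrix κ κ D) :
    ∃ (P : Matrix (Fin (rowRank M)) κ D) (Q : Matrix κ (Fin (rowRank M)) D), P * M * Q = 1 := by
  let b : (LinearMap.range M.vecMulLinear) ≃ₗ[D] (Fin (rowRank M) → D) :=
    LinearEquiv.ofFinrankEq _ _ (by rw [Module.finrank_fin_fun, rowRank])
  obtain ⟨σ, hσ⟩ := LinearMap.exists_rightInverse_of_surjective M.vecMulLinear.rangeRestrict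
    (LinearMap.range_rangeRestrict _)
  obtain ⟨τ, hτ⟩ := LinearMap.exists_leftInverse_of_injective
    (LinearMap.range M.vecMulLinear).subtype (Submodule.ker_subtype _)
  let p := σ ∘ₗ b.symm.toLinearMap
  let q := b.toLinearMap ∘ₗ τ
  refine ⟨LinearMap.toMatrixRight' p, LinearMap.toMatrixRight' q, ?_⟩
  apply Matrix.toLinearMapRight'.injective
  rw [Matrix.toLinearMapRight'_mul, Matrix.toLinearMapRight'_mul, Matrix.toLinearMapRight'_one]
  have e1 : (toLinearMapRight' (LinearMap.toMatrixRight' p)) = p :=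
    LinearEquiv.symm_apply_apply _ _
  have e2 : (toLinearMapRight' (LinearMap.toMatrixRight' q)) = q :=
    LinearEquiv.symm_apply_apply _ _
  rw [e1, e2]
  refine LinearMap.ext fun v => ?_
  have h1 := LinearMap.congr_fun hσ (b.symm v)
  have h2 := LinearMap.congr_fun hτ (b.symm v)
  have h3 : M.toLinearMapRight' (p v) = (b.symm v : κ → D) := congrArg Subtype.val h1
  simp only [LinearMap.comp_apply] at *
  rw [h3]
  change b (τ (b.symm v : κ → D)) = v
  have h4 : τ (b.symm v : κ → D) = b.symm v := h2
  rw [h4, LinearEquiv.apply_symm_apply]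

theorem card_le_rowRank_add_rowRank_one_sub [DecidableEq κ] (M : Matrix κ κ D) :
    Fintype.card κ ≤ rowRank M + rowRank (1 - M) := by
  have h : (⊤ : Submodule D (κ → D)) ≤
      LinearMap.range M.vecMulLinear ⊔ LinearMap.range (1 - M).vecMulLinear := by
    intro v _
    refine Submodule.mem_sup.2 ⟨_, ⟨v, rfl⟩, _, ⟨v, rfl⟩, ?_⟩
    simp
  calc Fintype.card κ = Module.finrank D (⊤ : Submodule D (κ → D)) := by simp
    _ ≤ _ := Submodule.finrank_mono h
    _ ≤ _ := Submodule.finrank_add_le_finrank_add_finrank _ _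

theorem sum_rowRank_le {N : Type*} [Fintype N] (M : N → Matrix κ κ D)
    (hid : ∀ l, IsIdempotentElem (M l)) (horth : ∀ l l', l ≠ l' → M l * M l' = 0) :
    ∑ l, rowRank (M l) ≤ Fintype.card κ := by
  classical
  let V : N → Submodule D (κ → D) := fun l => LinearMap.range (M l).vecMulLinear
  let s : (∀ l, V l) →ₗ[D] (κ → D) := ∑ l, (V l).subtype ∘ₗ LinearMap.proj l
  have hs : ∀ w : ∀ l, V l, s w = ∑ l, (w l : κ → D) := fun w => by
    simp [s, LinearMap.sum_apply]
  have hfix : ∀ l (w : V l), (w : κ → D) ᵥ* M l = w := by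
    rintro l ⟨_, v, rfl⟩
    simp [Matrix.vecMul_vecMul, (hid l).eq]
  have hkill : ∀ l l', l ≠ l' → ∀ (w : V l), (w : κ → D) ᵥ* M l' = 0 := by
    rintro l l' hne ⟨_, v, rfl⟩
    simp [Matrix.vecMul_vecMul, horth l l' hne]
  have hinj : Function.Injective s := by
    rw [← LinearMap.ker_eq_bot, LinearMap.ker_eq_bot']
    intro w hw
    funext l
    have h1 : s w ᵥ* M l = (w l : κ → D) := by
      rw [hs, Matrix.sum_vecMul, Finset.sum_eq_single l]
      · exact hfix l _
      · intro l' _ hne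
        exact hkill l' l hne _
      · simp
    rw [hw, Matrix.zero_vecMul] at h1
    exact Subtype.ext h1.symm
  have := LinearMap.finrank_le_finrank_of_injective hinj
  rw [Module.finrank_pi_fintype] at this
  simpa [rowRank, V] using this

end DivisionRing

/-! ### Stable ranks of matrices over a local ring -/

section Stable

variable {k : Type*} [Field k]

/-- Elements of the Jacobson radical of a `k`-algebra act nilpotently in every finite dimensional
representation. -/
theorem isNilpotent_map_of_mem_jacobson {B : Type*} [Ring B] [Algebra k B] {ι : Type*} [Fintype ι]
    [DecidableEq ι] (φ : B →ₐ[k] Matrix ι ι k) {x : B} (hx : x ∈ (⊥ : Ideal B).jacobson) :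
    IsNilpotent (φ x) := by
  obtain ⟨r, hr, hXr⟩ := Polynomial.exists_eq_pow_rootMultiplicity_mul_and_not_dvd (φ x).charpoly
    (φ x).charpoly_monic.ne_zero 0
  set a := (φ x).charpoly.rootMultiplicity 0
  rw [map_zero, sub_zero] at hr hXr
  obtain ⟨r', hr'⟩ : ∃ r', r = C (r.coeff 0) + r' * X := by
    obtain ⟨r', h⟩ : X ∣ r - C (r.coeff 0) := by
      rw [Polynomial.X_dvd_iff]; simp
    exact ⟨r', by rw [mul_comm, ← h]; ring⟩
  have hc : r.coeff 0 ≠ 0 := fun h => hXr (Polynomial.X_dvd_iff.2 h)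
  set c := r.coeff 0
  obtain ⟨z, hz⟩ := Ideal.mem_jacobson_iff.1 hx (c⁻¹ • aeval x r')
  rw [Ideal.mem_bot, sub_eq_zero] at hz
  have hz' : z * (c⁻¹ • aeval x r) = 1 := by
    rw [hr', map_add, map_mul, aeval_C, aeval_X, smul_add, Algebra.algebraMap_eq_smul_one,
      smul_smul, inv_mul_cancel₀ hc, one_smul, mul_add, mul_one, ← smul_mul_assoc, ← mul_assoc,
      add_comm]
    exact hz
  have hφ : φ z * (c⁻¹ • aeval (φ x) r) = 1 := by
    have := congrArg φ hz'
    rwa [map_mul, map_smul, ← Polynomial.aeval_algHom_apply, map_one] at this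
  refine ⟨a, ?_⟩
  have h0 : aeval (φ x) r * φ x ^ a = 0 := by
    have := (φ x).aeval_self_charpoly
    rwa [hr, mul_comm, map_mul, map_pow, aeval_X] at this
  calc φ x ^ a = φ z * (c⁻¹ • aeval (φ x) r) * φ x ^ a := by rw [hφ, one_mul]
    _ = 0 := by rw [mul_assoc, smul_mul_assoc, h0, smul_zero, mul_zero]

variable {D : Type*} [Ring D] [Algebra k D] {F : Type*} [DivisionRing F] (π : D →+* F)
  (hπ : Function.Surjective π) (hker : ∀ x, π x = 0 → x ∈ (⊥ : Ideal D).jacobson)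
  {ι : Type*} [Fintype ι] [DecidableEq ι] (ρ : D →ₐ[k] Matrix ι ι k)
  {κ : Type*} [Fintype κ] [DecidableEq κ]

include hker in
theorem mem_jacobson_matrix (w : Matrix κ κ D) (hw : w.map π = 0) :
    w ∈ (⊥ : Ideal (Matrix κ κ D)).jacobson := by
  have h := Ideal.matrix_jacobson_le (n := κ) (⊥ : Ideal D)
  rw [Ideal.matrix_bot] at h
  exact h fun i j => hker _ (congrFun (congrFun hw i) j)

/-- A representation of `D` of degree `ι` extended to matrices over `D`. -/
noncomputable def matrixRep : Matrix κ κ D →ₐ[k] Matrix (κ × ι) (κ × ι) k :=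
  (Matrix.compAlgEquiv κ ι k k).toAlgHom.comp ρ.mapMatrix

theorem comp_map_mul {κ₁ κ₂ κ₃ : Type*} [Fintype κ₂] (M : Matrix κ₁ κ₂ D)
    (N : Matrix κ₂ κ₃ D) : Matrix.comp _ _ _ _ k ((M * N).map ρ) =
      Matrix.comp _ _ _ _ k (M.map ρ) * Matrix.comp _ _ _ _ k (N.map ρ) := by
  ext ⟨i, a⟩ ⟨j, b⟩
  rw [Matrix.map_mul, Matrix.mul_apply, Fintype.sum_prod_type]
  change (∑ x, M.map ρ i x * N.map ρ x j) a b = _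
  rw [Matrix.sum_apply]
  rfl

include hπ hker in
/-- An identity block of `w` over the residue division ring becomes, up to the radical, an identity
block of `w` over `D`, and survives in every representation of `D`. -/
theorem card_mul_rowRank_le (w : Matrix κ κ D) :
    Fintype.card ι * rowRank (w.map π) ≤ (matrixRep ρ w).rank := by
  obtain ⟨P, Q, hPQ⟩ := exists_mul_mul_eq_one (w.map π)
  obtain ⟨σ, hσ⟩ := hπ.hasRightInverse
  have hP : (P.map σ).map π = P := by ext; simp [hσ _]
  have hQ : (Q.map σ).map π = Q := by ext; simp [hσ _]
  set u := P.map σ * w * Q.map σ with hu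
  have hu1 : (u - 1).map π = 0 := by
    rw [Matrix.map_sub _ (map_sub π), Matrix.map_one _ (map_zero π) (map_one π), hu,
      Matrix.map_mul, Matrix.map_mul, hP, hQ, hPQ, sub_self]
  obtain ⟨z, hz⟩ := Ideal.exists_mul_sub_mem_of_sub_one_mem_jacobson _
    (mem_jacobson_matrix π hker _ hu1)
  rw [Ideal.mem_bot, sub_eq_zero] at hz
  have hunit : IsUnit (matrixRep ρ u) := by
    have := congrArg (matrixRep ρ) hz
    rw [map_mul, map_one] at this
    exact IsUnit.of_mul_eq_one_right _ this
  have hr := Matrix.rank_of_isUnit _ hunit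
  have hmul : matrixRep ρ u = Matrix.comp _ _ _ _ k ((P.map σ).map ρ) * matrixRep ρ w *
      Matrix.comp _ _ _ _ k ((Q.map σ).map ρ) := by
    change Matrix.comp _ _ _ _ k (u.map ρ) = _
    rw [hu, comp_map_mul, comp_map_mul]
    rfl
  rw [hmul] at hr
  have h1 := (Matrix.rank_mul_le_left (Matrix.comp _ _ _ _ k ((P.map σ).map ρ) * matrixRep ρ w)
    (Matrix.comp _ _ _ _ k ((Q.map σ).map ρ))).trans (Matrix.rank_mul_le_right _ _)
  rw [hr, Fintype.card_prod, Fintype.card_fin, mul_comm] at h1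
  exact h1

include hπ hker in
/-- If a matrix `w` over the local ring `D` is idempotent modulo the radical, then the rank of high
powers of `w` in a representation of `D` is the degree of the representation times the rank of `w`
over the residue division ring. -/
theorem rank_matrixRep_pow (w : Matrix κ κ D) (hw : IsIdempotentElem (w.map π)) :
    ∃ s₀, ∀ s ≥ s₀, (matrixRep ρ w ^ s).rank = Fintype.card ι * rowRank (w.map π) := by
  have hmap1 : (1 - w).map π = 1 - w.map π := by
    rw [Matrix.map_sub _ (map_sub π), Matrix.map_one _ (map_zero π) (map_one π)]
  have hpow : ∀ (v : Matrix κ κ D), IsIdempotentElem (v.map π) → ∀ s : ℕ,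
      (v ^ (s + 1)).map π = v.map π := fun v hv s => by
    have : (v ^ (s + 1)).map π = (v.map π) ^ (s + 1) := map_pow π.mapMatrix v (s + 1)
    rw [this, hv.pow_succ_eq]
  obtain ⟨s₀, hs₀⟩ := isNilpotent_map_of_mem_jacobson (matrixRep (κ := κ) ρ)
    (mem_jacobson_matrix π hker (w * (1 - w)) (by
      rw [Matrix.map_mul, hmap1, mul_sub, mul_one, hw.eq, sub_self]))
  refine ⟨s₀ + 1, fun s hs => ?_⟩
  obtain ⟨t, rfl⟩ : ∃ t, s = t + 1 := ⟨s - 1, by omega⟩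
  -- The lower bounds for `w` and `1 - w` add up to the full degree, which also bounds the sum of
  -- the two ranks.
  have h1 := card_mul_rowRank_le π hπ hker ρ (w ^ (t + 1))
  have h2 := card_mul_rowRank_le π hπ hker ρ ((1 - w) ^ (t + 1))
  rw [hpow w hw, map_pow] at h1
  rw [hpow (1 - w) (by rw [hmap1]; exact hw.one_sub), hmap1, map_pow] at h2
  have hcomm : Commute (matrixRep ρ w) (matrixRep ρ (1 - w)) :=
    ((Commute.one_right w).sub_right (Commute.refl w)).map (matrixRep ρ)
  have h0 : matrixRep ρ w ^ (t + 1) * matrixRep ρ (1 - w) ^ (t + 1) = 0 := by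
    rw [← hcomm.mul_pow, ← map_mul]
    exact pow_eq_zero_of_le (by omega) hs₀
  have h3 := Matrix.rank_add_rank_le_card_of_mul_eq_zero h0
  have h4 := card_le_rowRank_add_rowRank_one_sub (w.map π)
  rw [Fintype.card_prod] at h3
  have h5 := Nat.mul_le_mul_left (Fintype.card ι) h4
  rw [mul_add, mul_comm] at h5
  omega

end Stable

end

noncomputable section

open Matrix Kronecker

/-! ### Graded commutants -/

section Commutant

variable {k : Type*} [Field k] {R : Type*} [CommRing R] [Algebra k R] {d : ℕ} [NeZero d]
  (ζ : k) {ι κ : Type*} [Fintype ι] [DecidableEq ι] [Fintype κ] [DecidableEq κ]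

variable (R ι) in
/-- The grading operator on a free `ℤ/d`-graded module with `ι` basis vectors in each degree: it
acts on degree `i` as `ζ ^ i`. For `ζ` a primitive `d`-th root of unity, a matrix commutes with it
if and only if it preserves degrees. -/
def gradMatrix : Matrix (ZMod d × ι) (ZMod d × ι) R :=
  Matrix.diagonal fun p => algebraMap k R (ζ ^ p.1.val)

theorem zeta_pow_val_injective {ζ : k} (hζ : IsPrimitiveRoot ζ d) {i j : ZMod d}
    (h : ζ ^ i.val = ζ ^ j.val) : i = j :=
  ZMod.val_injective d (hζ.pow_inj (ZMod.val_lt i) (ZMod.val_lt j) h)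

/-- The degree preserving endomorphisms of a free `ℤ/d`-graded module which commute with `A`. -/
def gradedCommutant (A : Matrix (ZMod d × ι) (ZMod d × ι) R) :
    Subalgebra k (Matrix (ZMod d × ι) (ZMod d × ι) R) :=
  Subalgebra.centralizer k {A, gradMatrix R ζ ι}

variable (κ) in
/-- The degree preserving endomorphisms of the tensor product of two free graded modules which
commute with `A ⊗ 1`. -/
def tensorCommutant (A : Matrix (ZMod d × ι) (ZMod d × ι) R) :
    Subalgebra k (Matrix ((ZMod d × ι) × (ZMod d × κ)) ((ZMod d × ι) × (ZMod d × κ)) R) :=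
  Subalgebra.centralizer k {A ⊗ₖ (1 : Matrix (ZMod d × κ) (ZMod d × κ) R),
    gradMatrix R ζ ι ⊗ₖ gradMatrix R ζ κ}

/-- The matrix `A` of a graded map describes an object with local endomorphism ring which is not
isomorphic to any of its nontrivial shifts. Isomorphisms with shifts are expressed as invertible
matrices which commute with `A` and change the degree by `j' - j ≠ 0`. -/
structure IsRigidLocal (A : Matrix (ZMod d × ι) (ZMod d × ι) R) : Prop where
  isUnit_or : ∀ u ∈ gradedCommutant ζ A, IsUnit u ∨ IsUnit (1 - u)
  not_isUnit : ∀ j j' : ZMod d, j ≠ j' → ∀ U : Matrix (ZMod d × ι) (ZMod d × ι) R, Commute U A →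
    ζ ^ j.val • (gradMatrix R ζ ι * U) = ζ ^ j'.val • (U * gradMatrix R ζ ι) → ¬ IsUnit U

variable {ζ}

theorem mem_gradedCommutant {A u : Matrix (ZMod d × ι) (ZMod d × ι) R} :
    u ∈ gradedCommutant ζ A ↔ Commute u A ∧ Commute u (gradMatrix R ζ ι) := by
  simp only [gradedCommutant, Subalgebra.mem_centralizer_iff, Set.mem_insert_iff,
    Set.mem_singleton_iff, forall_eq_or_imp, forall_eq]
  exact and_congr eq_comm eq_comm

theorem mem_tensorCommutant {A : Matrix (ZMod d × ι) (ZMod d × ι) R}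
    {E : Matrix ((ZMod d × ι) × (ZMod d × κ)) ((ZMod d × ι) × (ZMod d × κ)) R} :
    E ∈ tensorCommutant ζ κ A ↔ Commute E (A ⊗ₖ (1 : Matrix (ZMod d × κ) (ZMod d × κ) R)) ∧
      Commute E (gradMatrix R ζ ι ⊗ₖ gradMatrix R ζ κ) := by
  simp only [tensorCommutant, Subalgebra.mem_centralizer_iff, Set.mem_insert_iff,
    Set.mem_singleton_iff, forall_eq_or_imp, forall_eq]
  exact and_congr eq_comm eq_comm

/-- A matrix preserving degrees is block diagonal. -/
theorem apply_eq_zero_of_mem_gradedCommutant (hζ : IsPrimitiveRoot ζ d)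
    {A u : Matrix (ZMod d × ι) (ZMod d × ι) R} (hu : u ∈ gradedCommutant ζ A)
    {p q : ZMod d × ι} (hpq : p.1 ≠ q.1) : u p q = 0 := by
  have h := congrFun (congrFun (mem_gradedCommutant.1 hu).2.eq p) q
  rw [gradMatrix, Matrix.mul_diagonal, Matrix.diagonal_mul, mul_comm, ← sub_eq_zero, ← sub_mul,
    ← map_sub] at h
  have hne : ζ ^ q.1.val - ζ ^ p.1.val ≠ 0 :=
    sub_ne_zero.2 fun h => hpq (zeta_pow_val_injective hζ h).symm
  exact ((IsUnit.mk0 _ hne).map (algebraMap k R)).mul_right_eq_zero.1 h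

theorem inv_mem_gradedCommutant {A u : Matrix (ZMod d × ι) (ZMod d × ι) R}
    (hu : u ∈ gradedCommutant ζ A) (h : IsUnit u) :
    ∃ v ∈ gradedCommutant ζ A, v * u = 1 ∧ u * v = 1 := by
  obtain ⟨V, rfl⟩ := h
  obtain ⟨h1, h2⟩ := mem_gradedCommutant.1 hu
  exact ⟨↑V⁻¹, mem_gradedCommutant.2 ⟨h1.units_inv_left, h2.units_inv_left⟩, V.inv_mul, V.mul_inv⟩

/-- In the commutant of a rigid local matrix, the non-invertible matrices form the radical. -/
theorem IsRigidLocal.mem_jacobson {A : Matrix (ZMod d × ι) (ZMod d × ι) R} (hA : IsRigidLocal ζ A)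
    (u : gradedCommutant ζ A) (hu : ¬ IsUnit (u : Matrix (ZMod d × ι) (ZMod d × ι) R)) :
    u ∈ (⊥ : Ideal (gradedCommutant ζ A)).jacobson := by
  rw [Ideal.mem_jacobson_iff]
  intro y
  have hy : IsUnit (1 - (-(y * u) : gradedCommutant ζ A) :
      Matrix (ZMod d × ι) (ZMod d × ι) R) := by
    refine (hA.isUnit_or _ (-(y * u)).2).resolve_left fun h => hu ?_
    have h' : IsUnit ((y : Matrix (ZMod d × ι) (ZMod d × ι) R) * u) := by
      have := h.neg
      simpa using this
    rw [Matrix.isUnit_iff_isUnit_det] at h' ⊢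
    rw [Matrix.det_mul] at h'
    exact isUnit_of_mul_isUnit_right h'
  obtain ⟨v, hv, hv1, -⟩ := inv_mem_gradedCommutant (1 - -(y * u)).2 hy
  refine ⟨⟨v, hv⟩, ?_⟩
  rw [Ideal.mem_bot, sub_eq_zero]
  apply Subtype.ext
  rw [sub_neg_eq_add, add_comm] at hv1
  simpa [mul_add, mul_assoc] using hv1

/-! ### Slices of endomorphisms of a tensor product -/

/-- The component `X → X` of an endomorphism `E` of `X ⊗ Y` at the basis vectors `q` (source) and
`p` (target) of `Y`. -/
def slice {Ω Ω' : Type*} (E : Matrix (Ω × Ω') (Ω × Ω') R) (p q : Ω') : Matrix Ω Ω R :=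
  Matrix.of fun x y => E (x, p) (y, q)

section Slice

variable {Ω Ω' : Type*}

omit [CommRing R] in
theorem slice_ext {E E' : Matrix (Ω × Ω') (Ω × Ω') R} (h : ∀ p q, slice E p q = slice E' p q) :
    E = E' := by
  ext ⟨x, p⟩ ⟨y, q⟩
  exact congrFun (congrFun (h p q) x) y

theorem slice_kronecker (M : Matrix Ω Ω R) (M' : Matrix Ω' Ω' R) (p q : Ω') :
    slice (M ⊗ₖ M') p q = M' p q • M := by
  ext x y
  simp [slice, mul_comm]

variable [Fintype Ω] [Fintype Ω']

theorem slice_mul (E E' : Matrix (Ω × Ω') (Ω × Ω') R) (p q : Ω') :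
    slice (E * E') p q = ∑ r, slice E p r * slice E' r q := by
  ext x y
  rw [Matrix.sum_apply]
  simp only [slice, Matrix.of_apply, Matrix.mul_apply, Fintype.sum_prod_type_right]

variable [DecidableEq Ω']

theorem slice_kronecker_diagonal_mul (M : Matrix Ω Ω R) (v : Ω' → R)
    (E : Matrix (Ω × Ω') (Ω × Ω') R) (p q : Ω') :
    slice (M ⊗ₖ Matrix.diagonal v * E) p q = v p • (M * slice E p q) := by
  rw [slice_mul, Finset.sum_eq_single p]
  · rw [slice_kronecker, Matrix.diagonal_apply_eq, Matrix.smul_mul]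
  · intro r _ hr
    rw [slice_kronecker, Matrix.diagonal_apply_ne' _ hr, zero_smul, zero_mul]
  · simp

theorem slice_mul_kronecker_diagonal (M : Matrix Ω Ω R) (v : Ω' → R)
    (E : Matrix (Ω × Ω') (Ω × Ω') R) (p q : Ω') :
    slice (E * M ⊗ₖ Matrix.diagonal v) p q = v q • (slice E p q * M) := by
  rw [slice_mul, Finset.sum_eq_single q]
  · rw [slice_kronecker, Matrix.diagonal_apply_eq, Matrix.mul_smul]
  · intro r _ hr
    rw [slice_kronecker, Matrix.diagonal_apply_ne _ hr, zero_smul, mul_zero]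
  · simp

end Slice

theorem mem_tensorCommutant_iff_slice {A : Matrix (ZMod d × ι) (ZMod d × ι) R}
    {E : Matrix ((ZMod d × ι) × (ZMod d × κ)) ((ZMod d × ι) × (ZMod d × κ)) R} :
    E ∈ tensorCommutant ζ κ A ↔ ∀ p q, Commute (slice E p q) A ∧
      ζ ^ p.1.val • (gradMatrix R ζ ι * slice E p q) =
        ζ ^ q.1.val • (slice E p q * gradMatrix R ζ ι) := by
  rw [mem_tensorCommutant]
  have h1 : ∀ p q, slice (E * A ⊗ₖ (1 : Matrix (ZMod d × κ) (ZMod d × κ) R)) p q =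
      slice E p q * A := fun p q => by
    rw [← Matrix.diagonal_one, slice_mul_kronecker_diagonal, one_smul]
  have h2 : ∀ p q, slice (A ⊗ₖ (1 : Matrix (ZMod d × κ) (ZMod d × κ) R) * E) p q =
      A * slice E p q := fun p q => by
    rw [← Matrix.diagonal_one, slice_kronecker_diagonal_mul, one_smul]
  have h3 : ∀ p q, slice (E * gradMatrix R ζ ι ⊗ₖ gradMatrix R ζ κ) p q =
      ζ ^ q.1.val • (slice E p q * gradMatrix R ζ ι) := fun p q => by
    rw [gradMatrix.eq_def R ζ κ, slice_mul_kronecker_diagonal, algebraMap_smul]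
  have h4 : ∀ p q, slice (gradMatrix R ζ ι ⊗ₖ gradMatrix R ζ κ * E) p q =
      ζ ^ p.1.val • (gradMatrix R ζ ι * slice E p q) := fun p q => by
    rw [gradMatrix.eq_def R ζ κ, slice_kronecker_diagonal_mul, algebraMap_smul]
  constructor
  · rintro ⟨ha, hb⟩ p q
    refine ⟨?_, ?_⟩
    · rw [Commute, SemiconjBy, ← h1, ha.eq, h2]
    · rw [← h4, ← hb.eq, h3]
  · intro h
    refine ⟨slice_ext fun p q => ?_, slice_ext fun p q => ?_⟩
    · rw [h1, h2, (h p q).1.eq]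
    · rw [h3, h4, (h p q).2]

theorem slice_mem_gradedCommutant (hζ : IsPrimitiveRoot ζ d)
    {A : Matrix (ZMod d × ι) (ZMod d × ι) R}
    {E : Matrix ((ZMod d × ι) × (ZMod d × κ)) ((ZMod d × ι) × (ZMod d × κ)) R}
    (hE : E ∈ tensorCommutant ζ κ A) {p q : ZMod d × κ} (hpq : p.1 = q.1) :
    slice E p q ∈ gradedCommutant ζ A := by
  obtain ⟨h1, h2⟩ := mem_tensorCommutant_iff_slice.1 hE p q
  rw [hpq] at h2
  have hne : ζ ^ q.1.val ≠ 0 := pow_ne_zero _ (hζ.ne_zero (NeZero.ne d))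
  exact mem_gradedCommutant.2 ⟨h1, ((smul_right_injective _ hne) h2).symm⟩

theorem slice_mul_slice_mem (hζ : IsPrimitiveRoot ζ d) {A : Matrix (ZMod d × ι) (ZMod d × ι) R}
    {E E' : Matrix ((ZMod d × ι) × (ZMod d × κ)) ((ZMod d × ι) × (ZMod d × κ)) R}
    (hE : E ∈ tensorCommutant ζ κ A) (hE' : E' ∈ tensorCommutant ζ κ A)
    {p q r : ZMod d × κ} (hpq : p.1 = q.1) :
    slice E p r * slice E' r q ∈ gradedCommutant ζ A := by
  obtain ⟨h1, h2⟩ := mem_tensorCommutant_iff_slice.1 hE p r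
  obtain ⟨h3, h4⟩ := mem_tensorCommutant_iff_slice.1 hE' r q
  refine mem_gradedCommutant.2 ⟨h1.mul_left h3, ?_⟩
  have hne : ζ ^ q.1.val ≠ 0 := pow_ne_zero _ (hζ.ne_zero (NeZero.ne d))
  refine smul_right_injective _ hne ?_
  change ζ ^ q.1.val • (slice E p r * slice E' r q * gradMatrix R ζ ι) =
    ζ ^ q.1.val • (gradMatrix R ζ ι * (slice E p r * slice E' r q))
  rw [mul_assoc, ← mul_smul_comm, ← h4, mul_smul_comm, ← mul_assoc, ← smul_mul_assoc, ← h2,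
    smul_mul_assoc, hpq, mul_assoc]

/-- A round trip through a nontrivial shift is never invertible. -/
theorem IsRigidLocal.not_isUnit_slice_mul {A : Matrix (ZMod d × ι) (ZMod d × ι) R}
    (hA : IsRigidLocal ζ A)
    {E : Matrix ((ZMod d × ι) × (ZMod d × κ)) ((ZMod d × ι) × (ZMod d × κ)) R}
    (hE : E ∈ tensorCommutant ζ κ A) {p r : ZMod d × κ} (hpr : p.1 ≠ r.1)
    (M : Matrix (ZMod d × ι) (ZMod d × ι) R) : ¬ IsUnit (slice E p r * M) := by
  obtain ⟨h1, h2⟩ := mem_tensorCommutant_iff_slice.1 hE p r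
  intro h
  refine hA.not_isUnit p.1 r.1 hpr _ h1 h2 ?_
  rw [Matrix.isUnit_iff_isUnit_det] at h ⊢
  rw [Matrix.det_mul] at h
  exact isUnit_of_mul_isUnit_left h

/-! ### The radical of the commutant of `A ⊗ 1` -/

/-- If `x = x π` and `1 + π y x` is left invertible for all `y`, then `x` is in the radical. -/
theorem mem_jacobson_of_mul_eq {B : Type*} [Ring B] {x π : B} (hx : x * π = x)
    (h : ∀ y, ∃ r, r * (1 + π * y * x) = 1) : x ∈ (⊥ : Ideal B).jacobson := by
  rw [Ideal.mem_jacobson_iff]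
  intro y
  obtain ⟨r, hr⟩ := h y
  refine ⟨1 - y * x * r * π, ?_⟩
  rw [Ideal.mem_bot]
  have h1 : y * x * (r * (1 + π * y * x)) * π = y * x := by rw [hr, mul_one, mul_assoc, hx]
  have h2 : (1 - y * x * r * π) * y * x + (1 - y * x * r * π) - 1 =
      y * x - y * x * r * (π * y * (x * 1)) - y * x * r * π := by noncomm_ring
  rw [h2, mul_one]
  have h3 : y * x * (r * (1 + π * y * x)) * π =
      y * x * r * π + y * x * r * (π * y * (x * π)) := by noncomm_ring
  rw [h3, hx] at h1
  nth_rw 1 [← h1]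
  abel

/-- The endomorphism of a tensor product with the single nonzero slice `u` at `(p, q)`. -/
def singleSlice {Ω Ω' : Type*} [DecidableEq Ω'] (u : Matrix Ω Ω R) (p q : Ω') :
    Matrix (Ω × Ω') (Ω × Ω') R := u ⊗ₖ Matrix.single p q 1

theorem slice_singleSlice {Ω Ω' : Type*} [DecidableEq Ω'] (u : Matrix Ω Ω R) (p q r s : Ω') :
    slice (singleSlice u p q) r s = if p = r ∧ q = s then u else 0 := by
  rw [singleSlice, slice_kronecker, Matrix.single_apply]
  split_ifs <;> simp

theorem singleSlice_mem {A : Matrix (ZMod d × ι) (ZMod d × ι) R}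
    {u : Matrix (ZMod d × ι) (ZMod d × ι) R} {p q : ZMod d × κ} (h1 : Commute u A)
    (h2 : ζ ^ p.1.val • (gradMatrix R ζ ι * u) = ζ ^ q.1.val • (u * gradMatrix R ζ ι)) :
    singleSlice u p q ∈ tensorCommutant ζ κ A := by
  refine mem_tensorCommutant_iff_slice.2 fun r s => ?_
  rw [slice_singleSlice]
  split_ifs with h
  · rw [← h.1, ← h.2]
    exact ⟨h1, h2⟩
  · simp

theorem singleSlice_mem_of_mem {A : Matrix (ZMod d × ι) (ZMod d × ι) R}
    {u : Matrix (ZMod d × ι) (ZMod d × ι) R} (p : ZMod d × κ) (hu : u ∈ gradedCommutant ζ A) :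
    singleSlice u p p ∈ tensorCommutant ζ κ A := by
  obtain ⟨h1, h2⟩ := mem_gradedCommutant.1 hu
  exact singleSlice_mem h1 (by rw [h2.eq])

theorem sum_singleSlice {Ω Ω' : Type*} [Fintype Ω'] [DecidableEq Ω']
    (E : Matrix (Ω × Ω') (Ω × Ω') R) : E = ∑ p, ∑ q, singleSlice (slice E p q) p q := by
  ext ⟨x, r⟩ ⟨y, s⟩
  simp only [Matrix.sum_apply]
  have : ∀ p q, singleSlice (slice E p q) p q (x, r) (y, s) =
      if p = r then if q = s then E (x, p) (y, q) else 0 else 0 := fun p q => by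
    have := congrFun (congrFun (slice_singleSlice (slice E p q) p q r s) x) y
    refine this.trans ?_
    by_cases h : p = r <;> by_cases h' : q = s <;> simp [h, h', slice]
  simp [this]

theorem singleSlice_mul {Ω Ω' : Type*} [Fintype Ω] [Fintype Ω'] [DecidableEq Ω']
    (u v : Matrix Ω Ω R) (p q r : Ω') :
    singleSlice u p q * singleSlice v q r = singleSlice (u * v) p r := by
  rw [singleSlice, singleSlice, ← Matrix.mul_kronecker_mul, Matrix.single_mul_single_same, mul_one,
    singleSlice]

theorem singleSlice_mul_mul {Ω Ω' : Type*} [Fintype Ω] [Fintype Ω'] [DecidableEq Ω']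
    (u v : Matrix Ω Ω R) (E : Matrix (Ω × Ω') (Ω × Ω') R) (p q r s : Ω') :
    singleSlice u p q * E * singleSlice v r s = singleSlice (u * slice E q r * v) p s := by
  refine slice_ext fun a b => ?_
  simp only [slice_mul, slice_singleSlice, ite_mul, mul_ite, zero_mul, mul_zero,
    Finset.sum_ite, ite_and]
  by_cases ha : p = a <;> by_cases hb : s = b <;>
    simp [ha, hb, Finset.filter_eq]

/-- A matrix in the commutant of `A ⊗ 1` all of whose degree preserving slices are non-invertible
lies in the radical: so do the matrices with just one of its slices. -/
theorem IsRigidLocal.mem_jacobson_tensorCommutant (hζ : IsPrimitiveRoot ζ d)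
    {A : Matrix (ZMod d × ι) (ZMod d × ι) R} (hA : IsRigidLocal ζ A)
    (E : tensorCommutant ζ κ A)
    (hE : ∀ (p q : ZMod d × κ) (h : p.1 = q.1),
      (⟨slice E.1 p q, slice_mem_gradedCommutant hζ E.2 h⟩ : gradedCommutant ζ A) ∈
        (⊥ : Ideal (gradedCommutant ζ A)).jacobson) :
    E ∈ (⊥ : Ideal (tensorCommutant ζ κ A)).jacobson := by
  have hmem : ∀ p q, singleSlice (slice E.1 p q) p q ∈ tensorCommutant ζ κ A := fun p q =>
    let h := mem_tensorCommutant_iff_slice.1 E.2 p q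
    singleSlice_mem h.1 h.2
  have hsum : E = ∑ p, ∑ q, (⟨_, hmem p q⟩ : tensorCommutant ζ κ A) := by
    apply Subtype.ext
    simp only [AddSubmonoidClass.coe_finsetSum]
    exact sum_singleSlice E.1
  rw [hsum]
  refine Ideal.sum_mem _ fun p _ => Ideal.sum_mem _ fun q _ => ?_
  have h1mem : (1 : Matrix (ZMod d × ι) (ZMod d × ι) R) ∈ gradedCommutant ζ A := one_mem _
  refine mem_jacobson_of_mul_eq (π := ⟨_, singleSlice_mem_of_mem q h1mem⟩)
    (Subtype.ext ?_) fun y => ?_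
  · change singleSlice _ p q * singleSlice 1 q q = singleSlice _ p q
    rw [singleSlice_mul, mul_one]
  · have ht : slice y.1 q p * slice E.1 p q ∈ gradedCommutant ζ A :=
      slice_mul_slice_mem hζ y.2 E.2 rfl
    have htJ : (⟨_, ht⟩ : gradedCommutant ζ A) ∈ (⊥ : Ideal (gradedCommutant ζ A)).jacobson := by
      by_cases hpq : q.1 = p.1
      · exact Ideal.mul_mem_left _
          (⟨slice y.1 q p, slice_mem_gradedCommutant hζ y.2 hpq⟩ : gradedCommutant ζ A)
          (hE p q hpq.symm)
      · exact hA.mem_jacobson _ (hA.not_isUnit_slice_mul y.2 hpq _)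
    obtain ⟨r, hr⟩ := Ideal.exists_mul_add_sub_mem_of_mem_jacobson _ htJ
    rw [Ideal.mem_bot, sub_eq_zero] at hr
    have hr' : r.1 * (slice y.1 q p * slice E.1 p q + 1) = 1 := congrArg Subtype.val hr
    refine ⟨⟨singleSlice r.1 q q + (1 - singleSlice 1 q q), add_mem (singleSlice_mem_of_mem q r.2)
      (sub_mem (one_mem _) (singleSlice_mem_of_mem q h1mem))⟩, Subtype.ext ?_⟩
    change (singleSlice r.1 q q + (1 - singleSlice 1 q q)) *
      (1 + singleSlice 1 q q * y.1 * singleSlice (slice E.1 p q) p q) = 1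
    rw [singleSlice_mul_mul, one_mul]
    set t := slice y.1 q p * slice E.1 p q
    have e : (singleSlice r.1 q q + (1 - singleSlice 1 q q)) * (1 + singleSlice t q q) =
        1 + (singleSlice r.1 q q + singleSlice r.1 q q * singleSlice t q q
          - singleSlice 1 q q) + (singleSlice t q q - singleSlice 1 q q * singleSlice t q q) := by
      noncomm_ring
    rw [e, singleSlice_mul, singleSlice_mul, one_mul, sub_self, add_zero]
    have e2 : singleSlice r.1 q q + singleSlice (r.1 * t) q q =
        singleSlice (1 : Matrix _ _ R) q q := by
      rw [← hr', singleSlice, singleSlice, singleSlice, ← Matrix.add_kronecker]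
      congr 1
      noncomm_ring
    rw [e2, sub_self, add_zero]

end Commutant

/-! ### Multiplicities -/

section OneSided

variable {k : Type*} [Field k] {R : Type*} [CommRing R] [Algebra k R] (ε : R →ₐ[k] k)
  {d : ℕ} [NeZero d] {ζ : k} {ι κ : Type*} [Fintype ι] [DecidableEq ι] [Fintype κ] [DecidableEq κ]

/-- The block of an endomorphism of a tensor product `X ⊗ Y` on `X_i ⊗ Y_j`, reduced to the residue
field. -/
def residueBlock
    (E : Matrix ((ZMod d × ι) × (ZMod d × κ)) ((ZMod d × ι) × (ZMod d × κ)) R) (i j : ZMod d) :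
    Matrix (κ × ι) (κ × ι) k :=
  Matrix.of fun x y => ε (E ((i, x.2), (j, x.1)) ((i, y.2), (j, y.1)))

/-- The action of the degree preserving endomorphisms on the reduction of the degree `i` part. -/
def degreeRep (hζ : IsPrimitiveRoot ζ d) (A : Matrix (ZMod d × ι) (ZMod d × ι) R) (i : ZMod d) :
    gradedCommutant ζ A →ₐ[k] Matrix ι ι k :=
  AlgHom.ofLinearMap
    { toFun := fun u => Matrix.of fun a b => ε (u.1 (i, a) (i, b))
      map_add' := fun u v => by ext; simp
      map_smul' := fun c u => by ext; simp }
    (by ext a b; by_cases h : a = b <;> simp [Matrix.one_apply, h])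
    (fun u v => by
      ext a b
      simp only [LinearMap.coe_mk, AddHom.coe_mk, Matrix.of_apply, Matrix.mul_apply,
        Subalgebra.coe_mul, Fintype.sum_prod_type]
      rw [Finset.sum_eq_single i, map_sum]
      · simp
      · intro i' _ hi
        refine Finset.sum_eq_zero fun c _ => ?_
        rw [apply_eq_zero_of_mem_gradedCommutant hζ u.2 (p := (i, a)) (q := (i', c)) hi.symm,
          zero_mul]
      · simp)

/-- The degree preserving slices of `E` in degree `j`, as a matrix over the endomorphism ring
of `X`. -/
def degreeSlices (hζ : IsPrimitiveRoot ζ d) {A : Matrix (ZMod d × ι) (ZMod d × ι) R}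
    (E : tensorCommutant ζ κ A) (j : ZMod d) : Matrix κ κ (gradedCommutant ζ A) :=
  Matrix.of fun b b' => ⟨slice E.1 (j, b) (j, b'), slice_mem_gradedCommutant hζ E.2 rfl⟩

theorem matrixRep_degreeSlices (hζ : IsPrimitiveRoot ζ d)
    {A : Matrix (ZMod d × ι) (ZMod d × ι) R} (E : tensorCommutant ζ κ A) (i j : ZMod d) :
    matrixRep (degreeRep ε hζ A i) (degreeSlices hζ E j) = residueBlock ε E.1 i j := rfl

section Radical

variable {F : Type*} [Ring F] {A : Matrix (ZMod d × ι) (ZMod d × ι) R} (hA : IsRigidLocal ζ A)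
  (hζ : IsPrimitiveRoot ζ d) (π : gradedCommutant ζ A →+* F)
  (hπ : ∀ x ∈ (⊥ : Ideal (gradedCommutant ζ A)).jacobson, π x = 0)

include hA hπ in
/-- Modulo the radical, taking the degree preserving slices in degree `j` is multiplicative: the
other contributions to a product pass through a nontrivial shift. -/
theorem degreeSlices_mul_map (E E' : tensorCommutant ζ κ A) (j : ZMod d) :
    (degreeSlices hζ (E * E') j).map π =
      (degreeSlices hζ E j).map π * (degreeSlices hζ E' j).map π := by
  ext b b'
  have hsum : degreeSlices hζ (E * E') j b b' = ∑ r : ZMod d × κ,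
      (⟨_, slice_mul_slice_mem hζ E.2 E'.2 (p := (j, b)) (q := (j, b')) (r := r) rfl⟩ :
        gradedCommutant ζ A) := by
    apply Subtype.ext
    simp only [AddSubmonoidClass.coe_finsetSum]
    exact slice_mul E.1 E'.1 (j, b) (j, b')
  rw [Matrix.map_apply, hsum, map_sum, Fintype.sum_prod_type, Finset.sum_eq_single j]
  · rw [Matrix.mul_apply]
    refine Finset.sum_congr rfl fun c _ => ?_
    rw [Matrix.map_apply, Matrix.map_apply, ← map_mul]
    rfl
  · intro j' _ hj
    refine Finset.sum_eq_zero fun c _ => hπ _ (hA.mem_jacobson _ ?_)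
    exact hA.not_isUnit_slice_mul E.2 (p := (j, b)) (r := (j', c)) hj.symm _
  · simp

end Radical

/-- The endomorphism ring of a rigid local object modulo its radical is a division ring. -/
noncomputable abbrev IsRigidLocal.divisionRing [Nontrivial R] [Nonempty ι]
    {A : Matrix (ZMod d × ι) (ZMod d × ι) R} (hA : IsRigidLocal ζ A) :
    DivisionRing (gradedCommutant ζ A ⧸ (⊥ : Ideal (gradedCommutant ζ A)).jacobson) :=
  haveI : Nontrivial (gradedCommutant ζ A ⧸ (⊥ : Ideal (gradedCommutant ζ A)).jacobson) := by
    refine Ideal.Quotient.nontrivial_iff.2 fun h => ?_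
    rw [Ideal.jacobson_eq_top_iff] at h
    exact bot_ne_top h
  DivisionRing.ofIsUnitOrEqZero fun a => by
    obtain ⟨u, rfl⟩ := Ideal.Quotient.mk_surjective a
    by_cases hu : IsUnit (u : Matrix (ZMod d × ι) (ZMod d × ι) R)
    · left
      obtain ⟨v, hv, h1, h2⟩ := inv_mem_gradedCommutant u.2 hu
      have : IsUnit u := ⟨⟨u, ⟨v, hv⟩, Subtype.ext h2, Subtype.ext h1⟩, rfl⟩
      exact this.map _
    · right
      exact Ideal.Quotient.eq_zero_iff_mem.2 (hA.mem_jacobson u hu)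

/-- Let `A` be rigid and local. Orthogonal nonzero idempotents `E l` commuting with `A ⊗ 1` have
multiplicities `a l j`: those of the `j`-th shift of `X` in the image of `E l`. They are detected by
the ranks of high powers of the blocks of the reduction of `E l`. -/
theorem IsRigidLocal.exists_multiplicities [Nontrivial R] [Nonempty ι] (hζ : IsPrimitiveRoot ζ d)
    {A : Matrix (ZMod d × ι) (ZMod d × ι) R} (hA : IsRigidLocal ζ A) {N : Type*} [Fintype N]
    (E : N → Matrix ((ZMod d × ι) × (ZMod d × κ)) ((ZMod d × ι) × (ZMod d × κ)) R)
    (hE : ∀ l, E l ∈ tensorCommutant ζ κ A) (hid : ∀ l, IsIdempotentElem (E l))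
    (horth : ∀ l l', l ≠ l' → E l * E l' = 0) (hne : ∀ l, E l ≠ 0) :
    ∃ a : N → ZMod d → ℕ, (∀ j, ∑ l, a l j ≤ Fintype.card κ) ∧ (∀ l, ∃ j, a l j ≠ 0) ∧
      ∀ l i j, ∃ s₀, ∀ s ≥ s₀, (residueBlock ε (E l) i j ^ s).rank = Fintype.card ι * a l j := by
  let _ := hA.divisionRing
  let π := Ideal.Quotient.mk (⊥ : Ideal (gradedCommutant ζ A)).jacobson
  have hπ0 : ∀ x, π x = 0 ↔ x ∈ (⊥ : Ideal (gradedCommutant ζ A)).jacobson := fun x =>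
    Ideal.Quotient.eq_zero_iff_mem
  let e : N → tensorCommutant ζ κ A := fun l => ⟨E l, hE l⟩
  have hmul := degreeSlices_mul_map (κ := κ) hA hζ π fun x hx => (hπ0 x).2 hx
  have hidπ : ∀ l j, IsIdempotentElem ((degreeSlices hζ (e l) j).map π) := fun l j => by
    rw [IsIdempotentElem, ← hmul]
    congr 2
    exact Subtype.ext (hid l)
  refine ⟨fun l j => rowRank ((degreeSlices hζ (e l) j).map π), fun j => ?_, fun l => ?_,
    fun l i j => ?_⟩
  · refine sum_rowRank_le _ (fun l => hidπ l j) fun l l' hll => ?_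
    rw [← hmul]
    have : e l * e l' = 0 := Subtype.ext (horth l l' hll)
    rw [this]
    ext b b'
    exact map_zero π
  · -- If all multiplicities vanish, `E l` lies in the radical of the commutant of `A ⊗ 1`.
    by_contra! h
    have h0 : ∀ j, (degreeSlices hζ (e l) j).map π = 0 := fun j => by
      by_contra hj
      exact rowRank_ne_zero hj (h j)
    have hmem : e l ∈ (⊥ : Ideal (tensorCommutant ζ κ A)).jacobson := by
      refine hA.mem_jacobson_tensorCommutant hζ _ ?_
      rintro ⟨j, b⟩ ⟨j', b'⟩ (rfl : j = j')
      exact (hπ0 _).1 (congrFun (congrFun (h0 j) b) b')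
    -- An idempotent of the radical vanishes.
    obtain ⟨z, hz⟩ := Ideal.exists_mul_add_sub_mem_of_mem_jacobson _ (neg_mem hmem)
    rw [Ideal.mem_bot, sub_eq_zero] at hz
    have hz' : z * (1 - e l) = 1 := by rw [sub_eq_neg_add, hz]
    have hide : e l * e l = e l := Subtype.ext (hid l)
    have : e l = 0 := by
      calc e l = z * (1 - e l) * e l := by rw [hz', one_mul]
        _ = 0 := by rw [mul_assoc, sub_mul, one_mul, hide, sub_self, mul_zero]
    exact hne l (congrArg Subtype.val this)
  · obtain ⟨s₀, h⟩ := rank_matrixRep_pow π Ideal.Quotient.mk_surjective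
      (fun x hx => (hπ0 x).1 hx) (degreeRep ε hζ A i) (degreeSlices hζ (e l) j) (hidπ l j)
    exact ⟨s₀, fun s hs => by rw [← h s hs, matrixRep_degreeSlices]⟩

end OneSided

/-! ### Comparison of the two systems of multiplicities -/

section TwoSided

variable {k : Type*} [Field k] {d : ℕ} [NeZero d] {ζ : k}
  {ι κ : Type*} [Fintype ι] [DecidableEq ι] [Fintype κ] [DecidableEq κ]

section Twist

variable {R : Type*} [CommRing R] [Algebra k R]

variable (ι κ R) in
/-- The diagonal change of basis by `ζ ^ (i j)` on `X_i ⊗ Y_j`. -/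
def twistMatrix (ζ : k) : Matrix ((ZMod d × ι) × (ZMod d × κ)) ((ZMod d × ι) × (ZMod d × κ)) R :=
  Matrix.diagonal fun x => algebraMap k R ((ζ ^ x.2.1.val) ^ x.1.1.val)

/-- Conjugation with the diagonal matrix of the `ζ ^ (i j)`, followed by the exchange of the two
tensor factors. -/
def twistSwap (ζ : k)
    (E : Matrix ((ZMod d × ι) × (ZMod d × κ)) ((ZMod d × ι) × (ZMod d × κ)) R) :
    Matrix ((ZMod d × κ) × (ZMod d × ι)) ((ZMod d × κ) × (ZMod d × ι)) R :=
  (twistMatrix ι κ R ζ * E * twistMatrix ι κ R ζ⁻¹).submatrix (Equiv.prodComm _ _)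
    (Equiv.prodComm _ _)

theorem twistSwap_apply
    (E : Matrix ((ZMod d × ι) × (ZMod d × κ)) ((ZMod d × ι) × (ZMod d × κ)) R)
    (p p' : ZMod d × ι) (q q' : ZMod d × κ) :
    twistSwap ζ E (q, p) (q', p') = algebraMap k R ((ζ ^ q.1.val) ^ p.1.val) * E (p, q) (p', q') *
      algebraMap k R ((ζ⁻¹ ^ q'.1.val) ^ p'.1.val) := by
  simp [twistSwap, twistMatrix, Matrix.mul_diagonal, Matrix.diagonal_mul]

theorem twistMatrix_inv_mul (hζ : ζ ≠ 0) :
    twistMatrix (d := d) ι κ R ζ⁻¹ * twistMatrix ι κ R ζ = 1 := by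
  rw [twistMatrix, twistMatrix, Matrix.diagonal_mul_diagonal, ← Matrix.diagonal_one]
  congr 1
  funext x
  rw [← map_mul, ← mul_pow, ← mul_pow, inv_mul_cancel₀ hζ, one_pow, one_pow, map_one]

theorem twistSwap_mul (hζ : ζ ≠ 0)
    (E E' : Matrix ((ZMod d × ι) × (ZMod d × κ)) ((ZMod d × ι) × (ZMod d × κ)) R) :
    twistSwap ζ (E * E') = twistSwap ζ E * twistSwap ζ E' := by
  rw [twistSwap, twistSwap, twistSwap, Matrix.submatrix_mul_equiv]
  congr 1
  calc _ = twistMatrix ι κ R ζ * E * 1 * E' * twistMatrix ι κ R ζ⁻¹ := by noncomm_ring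
    _ = _ := by rw [← twistMatrix_inv_mul hζ]; noncomm_ring

theorem twistSwap_eq_zero (hζ : ζ ≠ 0)
    {E : Matrix ((ZMod d × ι) × (ZMod d × κ)) ((ZMod d × ι) × (ZMod d × κ)) R}
    (h : twistSwap ζ E = 0) : E = 0 := by
  ext ⟨p, q⟩ ⟨p', q'⟩
  have h1 := congrFun (congrFun h (q, p)) (q', p')
  rw [twistSwap_apply] at h1
  have hu : ∀ (z : k) (_ : z ≠ 0) (i j : ℕ), IsUnit (algebraMap k R ((z ^ i) ^ j)) :=
    fun z hz i j => (IsUnit.mk0 _ (pow_ne_zero _ (pow_ne_zero _ hz))).map _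
  exact (hu ζ hζ _ _).mul_right_eq_zero.1 ((hu ζ⁻¹ (inv_ne_zero hζ) _ _).mul_left_eq_zero.1 h1)

theorem twistSwap_gradMatrix (hζ : ζ ≠ 0) :
    twistSwap ζ (gradMatrix R ζ ι ⊗ₖ gradMatrix R ζ κ) =
      gradMatrix (d := d) R ζ κ ⊗ₖ gradMatrix R ζ ι := by
  ext ⟨q, p⟩ ⟨q', p'⟩
  rw [twistSwap_apply, Matrix.kronecker_apply, Matrix.kronecker_apply, gradMatrix, gradMatrix]
  by_cases hp : p = p'
  · by_cases hq : q = q'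
    · subst hp hq
      rw [mul_right_comm, ← map_mul, ← mul_pow, ← mul_pow, mul_inv_cancel₀ hζ, one_pow, one_pow,
        map_one, one_mul, mul_comm]
    · simp [Matrix.diagonal_apply_ne _ hq]
  · simp [Matrix.diagonal_apply_ne _ hp]

/-- The twist removes the sign `ζ ^ i` from `ζ ^ i ⊗ B`. -/
theorem twistSwap_gradMatrix_kronecker (hζ : IsPrimitiveRoot ζ d)
    (B : Matrix (ZMod d × κ) (ZMod d × κ) R) (hB : ∀ q q', q'.1 ≠ q.1 + 1 → B q q' = 0) :
    twistSwap ζ (gradMatrix R ζ ι ⊗ₖ B) = B ⊗ₖ (1 : Matrix (ZMod d × ι) (ZMod d × ι) R) := by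
  have hζ0 : ζ ≠ 0 := hζ.ne_zero (NeZero.ne d)
  ext ⟨q, p⟩ ⟨q', p'⟩
  rw [twistSwap_apply, Matrix.kronecker_apply, Matrix.kronecker_apply, gradMatrix]
  by_cases hp : p = p'
  · subst hp
    by_cases hq : q'.1 = q.1 + 1
    · have h1 : (ζ ^ q.1.val) ^ p.1.val * ζ ^ p.1.val * (ζ⁻¹ ^ q'.1.val) ^ p.1.val = 1 := by
        rw [hq, inv_pow, MatFac.zeta_pow_val_add_one hζ.pow_eq_one, ← mul_pow, ← mul_pow,
          mul_comm _ ζ, mul_inv_cancel₀ (mul_ne_zero hζ0 (pow_ne_zero _ hζ0)), one_pow]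
      rw [Matrix.diagonal_apply_eq, Matrix.one_apply_eq, ← mul_assoc, mul_right_comm, ← map_mul,
        ← map_mul, h1, map_one, one_mul, mul_one]
    · rw [hB q q' hq]; simp
  · simp [Matrix.diagonal_apply_ne _ hp, Matrix.one_apply_ne hp]

theorem residueBlock_twistSwap (hζ : ζ ≠ 0) (ε : R →ₐ[k] k)
    (E : Matrix ((ZMod d × ι) × (ZMod d × κ)) ((ZMod d × ι) × (ZMod d × κ)) R) (i j : ZMod d) :
    residueBlock ε (twistSwap ζ E) j i =
      (residueBlock ε E i j).submatrix (Equiv.prodComm ι κ) (Equiv.prodComm ι κ) := by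
  ext x y
  simp only [residueBlock, Matrix.of_apply, Matrix.submatrix_apply, twistSwap_apply]
  rw [mul_right_comm, ← map_mul, ← mul_pow, ← mul_pow, mul_inv_cancel₀ hζ, one_pow, one_pow,
    map_one, one_mul]
  rfl

end Twist

/-- Numerical conclusion: if `n a_j = m b_i` for multiplicities `a`, `b` of each of a number of
nonzero summands, with `a` summing up to at most `m`, then there are at most `gcd n m` summands. -/
theorem card_le_gcd {N J : Type*} [Fintype N] [Nonempty J] {n m : ℕ} (hn : 0 < n) (hm : 0 < m)
    (a b : N → J → ℕ) (hab : ∀ l i j, n * a l j = m * b l i) (ha : ∀ l, ∃ j, a l j ≠ 0)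
    (hsum : ∀ j, ∑ l, a l j ≤ m) : Fintype.card N ≤ Nat.gcd n m := by
  obtain ⟨j₀⟩ := ‹Nonempty J›
  have hl : ∀ l, Nat.lcm n m ≤ n * a l j₀ := fun l => by
    have hdvd : Nat.lcm n m ∣ n * a l j₀ :=
      Nat.lcm_dvd (Dvd.intro _ rfl) (by rw [hab l j₀ j₀]; exact Dvd.intro _ rfl)
    obtain ⟨j, hj⟩ := ha l
    refine Nat.le_of_dvd ?_ hdvd
    rw [hab l j₀ j₀, ← hab l j₀ j]
    exact Nat.mul_pos hn (Nat.pos_of_ne_zero hj)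
  have h1 : Fintype.card N * Nat.lcm n m ≤ Nat.gcd n m * Nat.lcm n m := by
    calc Fintype.card N * Nat.lcm n m = ∑ _l : N, Nat.lcm n m := by simp
      _ ≤ ∑ l, n * a l j₀ := Finset.sum_le_sum fun l _ => hl l
      _ = n * ∑ l, a l j₀ := by rw [Finset.mul_sum]
      _ ≤ n * m := Nat.mul_le_mul_left _ (hsum j₀)
      _ = _ := (Nat.gcd_mul_lcm n m).symm
  exact Nat.le_of_mul_le_mul_right h1 (Nat.lcm_pos hn hm)

/-- An idempotent matrix which vanishes at the residue field is zero. -/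
theorem eq_zero_of_map_eq_zero {S : Type*} [CommRing S] [Algebra k S] (ε : S →ₐ[k] k)
    [IsLocalHom ε] {Ω : Type*} [Fintype Ω] [DecidableEq Ω] {E : Matrix Ω Ω S}
    (hE : IsIdempotentElem E) (h : E.map ε = 0) : E = 0 := by
  have hu : IsUnit (1 - E) := isUnit_of_isUnit_map ε _ (by
    have : ε.mapMatrix E = 0 := h
    rw [map_sub, this, map_one, sub_zero]
    exact isUnit_one)
  exact hu.mul_right_eq_zero.1 (by rw [sub_mul, one_mul, hE.eq, sub_self])

omit [Fintype ι] [Fintype κ] [NeZero d] in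
theorem gradMatrix_kronecker_map {S R : Type*} [CommRing S] [CommRing R] [Algebra k S] [Algebra k R]
    (ρ : S →ₐ[k] R) : (gradMatrix (d := d) S ζ ι ⊗ₖ gradMatrix (d := d) S ζ κ).map ρ =
      gradMatrix (d := d) R ζ ι ⊗ₖ gradMatrix (d := d) R ζ κ := by
  ext ⟨p, q⟩ ⟨p', q'⟩
  simp only [Matrix.map_apply, Matrix.kronecker_apply, gradMatrix, Matrix.diagonal_apply, map_mul,
    apply_ite ρ, AlgHom.commutes, map_zero]

theorem eq_zero_of_map_eq_zero_of_comp {S R : Type*} [CommRing S] [CommRing R] [Algebra k S]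
    [Algebra k R] (ρ : S →ₐ[k] R) (ε' : R →ₐ[k] k) (ε : S →ₐ[k] k) [IsLocalHom ε]
    (h : ∀ s, ε' (ρ s) = ε s) {Ω : Type*} [Fintype Ω] [DecidableEq Ω] {E : Matrix Ω Ω S}
    (hE : IsIdempotentElem E) (h0 : E.map ρ = 0) : E = 0 := by
  refine eq_zero_of_map_eq_zero ε hE ?_
  ext x y
  have := congrFun (congrFun h0 x) y
  rw [Matrix.map_apply, Matrix.zero_apply] at this
  rw [Matrix.map_apply, ← h, this, map_zero, Matrix.zero_apply]

variable {S R₁ R₂ : Type*} [CommRing S] [CommRing R₁] [CommRing R₂] [Algebra k S] [Algebra k R₁]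
  [Algebra k R₂] [Nontrivial R₁] [Nontrivial R₂] [Nonempty ι] [Nonempty κ]

/-- The bound on the number of summands in matrix form. The matrix `Φ` of the tensor product
specializes to `A ⊗ 1` over `R₁` and to `ζ ^ i ⊗ B` over `R₂`; comparing the two systems of
multiplicities on the blocks over the residue field gives `n a_j = m b_i`. -/
theorem card_le_gcd_of_orthogonal_idempotents (hζ : IsPrimitiveRoot ζ d) (ρ₁ : S →ₐ[k] R₁)
    (ρ₂ : S →ₐ[k] R₂) (ε₁ : R₁ →ₐ[k] k) (ε₂ : R₂ →ₐ[k] k) (ε : S →ₐ[k] k) [IsLocalHom ε]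
    (h₁ : ∀ s, ε₁ (ρ₁ s) = ε s) (h₂ : ∀ s, ε₂ (ρ₂ s) = ε s)
    {A : Matrix (ZMod d × ι) (ZMod d × ι) R₁} (hA : IsRigidLocal ζ A)
    {B : Matrix (ZMod d × κ) (ZMod d × κ) R₂} (hB : IsRigidLocal ζ B)
    (hB' : ∀ q q', q'.1 ≠ q.1 + 1 → B q q' = 0)
    {Φ : Matrix ((ZMod d × ι) × (ZMod d × κ)) ((ZMod d × ι) × (ZMod d × κ)) S}
    (hΦ₁ : Φ.map ρ₁ = A ⊗ₖ (1 : Matrix (ZMod d × κ) (ZMod d × κ) R₁))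
    (hΦ₂ : Φ.map ρ₂ = gradMatrix R₂ ζ ι ⊗ₖ B) {N : Type*} [Fintype N]
    (E : N → Matrix ((ZMod d × ι) × (ZMod d × κ)) ((ZMod d × ι) × (ZMod d × κ)) S)
    (hΦ : ∀ l, Commute (E l) Φ) (hg : ∀ l, Commute (E l) (gradMatrix S ζ ι ⊗ₖ gradMatrix S ζ κ))
    (hid : ∀ l, IsIdempotentElem (E l)) (horth : ∀ l l', l ≠ l' → E l * E l' = 0)
    (hne : ∀ l, E l ≠ 0) :
    Fintype.card N ≤ Nat.gcd (Fintype.card ι) (Fintype.card κ) := by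
  have hζ0 : ζ ≠ 0 := hζ.ne_zero (NeZero.ne d)
  have hblock : ∀ l i j, residueBlock ε₁ ((E l).map ρ₁) i j =
      residueBlock ε₂ ((E l).map ρ₂) i j := by
    intro l i j
    ext x y
    simp [residueBlock, h₁, h₂]
  obtain ⟨a, ha1, ha2, ha3⟩ := hA.exists_multiplicities ε₁ hζ (κ := κ) (fun l => (E l).map ρ₁)
    (fun l => mem_tensorCommutant.2 ⟨by
        rw [← hΦ₁]; exact (hΦ l).map ρ₁.mapMatrix, by
        rw [← gradMatrix_kronecker_map ρ₁]; exact (hg l).map ρ₁.mapMatrix⟩)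
    (fun l => (hid l).map ρ₁.mapMatrix)
    (fun l l' h => by rw [← Matrix.map_mul, horth l l' h]; exact map_zero ρ₁.mapMatrix)
    (fun l h => hne l (eq_zero_of_map_eq_zero_of_comp ρ₁ ε₁ ε h₁ (hid l) h))
  obtain ⟨b, -, -, hb3⟩ := hB.exists_multiplicities ε₂ hζ (κ := ι)
    (fun l => twistSwap ζ ((E l).map ρ₂))
    (fun l => mem_tensorCommutant.2 ⟨by
        rw [← twistSwap_gradMatrix_kronecker hζ B hB', ← hΦ₂, Commute, SemiconjBy,
          ← twistSwap_mul hζ0, ← twistSwap_mul hζ0, ← Matrix.map_mul, ← Matrix.map_mul,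
          (hΦ l).eq], by
        rw [← twistSwap_gradMatrix hζ0, ← gradMatrix_kronecker_map ρ₂, Commute, SemiconjBy,
          ← twistSwap_mul hζ0, ← twistSwap_mul hζ0, ← Matrix.map_mul, ← Matrix.map_mul, (hg l).eq]⟩)
    (fun l => by
      rw [IsIdempotentElem, ← twistSwap_mul hζ0, ← Matrix.map_mul, (hid l).eq])
    (fun l l' h => by
      rw [← twistSwap_mul hζ0, ← Matrix.map_mul, horth l l' h]
      ext ⟨q, p⟩ ⟨q', p'⟩
      simp [twistSwap_apply])
    (fun l h => hne l
      (eq_zero_of_map_eq_zero_of_comp ρ₂ ε₂ ε h₂ (hid l) (twistSwap_eq_zero hζ0 h)))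
  refine card_le_gcd Fintype.card_pos Fintype.card_pos a b (fun l i j => ?_) ha2 ha1
  obtain ⟨s₁, hs₁⟩ := ha3 l i j
  obtain ⟨s₂, hs₂⟩ := hb3 l j i
  rw [← hs₁ (max s₁ s₂) (le_max_left _ _), ← hs₂ (max s₁ s₂) (le_max_right _ _), hblock,
    residueBlock_twistSwap hζ0]
  have hpow : ∀ (M : Matrix (κ × ι) (κ × ι) k) (s : ℕ),
      (M.submatrix (Equiv.prodComm ι κ) (Equiv.prodComm ι κ)) ^ s =
        (M ^ s).submatrix (Equiv.prodComm ι κ) (Equiv.prodComm ι κ) := fun M s =>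
    (map_pow (Matrix.reindexAlgEquiv k k (Equiv.prodComm ι κ).symm) M s).symm
  rw [hpow, Matrix.rank_submatrix]

end TwoSided

namespace MatFac

/-! ### Total modules and idempotents of matrix factorizations -/

section Total

variable {k : Type*} [Field k] {Q : Type u} [CommRing Q] [Algebra k Q] {d : ℕ} [NeZero d] {f : Q}

/-- The operator acting on the degree `i` part of the total module of `X` as `ζ ^ i`. -/
def totalGrad (ζ : k) (X : MatFac Q d f) : Module.End Q (∀ i, X.obj i) :=
  LinearMap.pi fun i => algebraMap k Q (ζ ^ i.val) • LinearMap.proj i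

omit [NeZero d] in
theorem totalGrad_apply (ζ : k) (X : MatFac Q d f) (u : ∀ i, X.obj i) (i : ZMod d) :
    totalGrad ζ X u i = algebraMap k Q (ζ ^ i.val) • u i := rfl

omit [NeZero d] in
theorem totalGrad_single (ζ : k) (X : MatFac Q d f) (i : ZMod d) (x : X.obj i) :
    totalGrad ζ X (Pi.single i x) = algebraMap k Q (ζ ^ i.val) • Pi.single i x := by
  funext j
  rw [totalGrad_apply, Pi.smul_apply]
  by_cases h : j = i
  · subst h; rfl
  · rw [Pi.single_eq_of_ne h, smul_zero, smul_zero]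

omit [NeZero d] in
theorem totalMap_single (X : MatFac Q d f) (i : ZMod d) (x : X.obj (i + 1)) :
    totalMap X.φ (Pi.single (i + 1) x) = Pi.single i (X.φ i x) := by
  funext j
  rw [totalMap_apply]
  by_cases h : j = i
  · subst h; simp
  · have : j + 1 ≠ i + 1 := fun h' => h (add_right_cancel h')
    rw [Pi.single_eq_of_ne h, Pi.single_eq_of_ne this, map_zero]

/-- Eigenvectors of the grading operator are homogeneous. -/
theorem eq_single_of_totalGrad {ζ : k} (hζ : IsPrimitiveRoot ζ d) {X : MatFac Q d f}
    {u : ∀ i, X.obj i} {i : ZMod d} (h : totalGrad ζ X u = algebraMap k Q (ζ ^ i.val) • u) :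
    u = Pi.single i (u i) := by
  funext j
  by_cases hj : j = i
  · subst hj; simp
  · rw [Pi.single_eq_of_ne hj]
    have h1 := congrFun h j
    rw [totalGrad_apply, Pi.smul_apply, ← sub_eq_zero, ← sub_smul, ← map_sub] at h1
    have hne : ζ ^ j.val - ζ ^ i.val ≠ 0 :=
      sub_ne_zero.2 fun h' => hj (zeta_pow_val_injective hζ h')
    exact ((IsUnit.mk0 _ hne).map (algebraMap k Q)).smul_eq_zero.1 h1

theorem apply_single_of_commutes {ζ : k} (hζ : IsPrimitiveRoot ζ d) {g : Q} {X : MatFac Q d f}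
    {Z : MatFac Q d g} {F : (∀ i, X.obj i) →ₗ[Q] ∀ i, Z.obj i}
    (hF : ∀ u, F (totalGrad ζ X u) = totalGrad ζ Z (F u)) (i : ZMod d) (x : X.obj i) :
    F (Pi.single i x) = Pi.single i (F (Pi.single i x) i) := by
  refine eq_single_of_totalGrad hζ ?_
  rw [← hF, totalGrad_single, map_smul]

/-- An isomorphism of total modules which respects the gradings and the structure maps is an
isomorphism of matrix factorizations. -/
theorem isomorphic_of_total {ζ : k} (hζ : IsPrimitiveRoot ζ d) {X Z : MatFac Q d f}
    (F : (∀ i, X.obj i) ≃ₗ[Q] ∀ i, Z.obj i)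
    (hφ : ∀ u, F (totalMap X.φ u) = totalMap Z.φ (F u))
    (hg : ∀ u, F (totalGrad ζ X u) = totalGrad ζ Z (F u)) : X.Isomorphic Z := by
  have hg' : ∀ u, F.symm (totalGrad ζ Z u) = totalGrad ζ X (F.symm u) := fun u => by
    rw [LinearEquiv.symm_apply_eq, hg, LinearEquiv.apply_symm_apply]
  have h1 := apply_single_of_commutes hζ (F := F.toLinearMap) hg
  have h2 := apply_single_of_commutes hζ (F := F.symm.toLinearMap) hg'
  simp only [LinearEquiv.coe_coe] at h1 h2
  refine ⟨fun i => LinearEquiv.ofLinearMap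
    (LinearMap.proj i ∘ₗ F.toLinearMap ∘ₗ LinearMap.single Q X.obj i)
    (LinearMap.proj i ∘ₗ F.symm.toLinearMap ∘ₗ LinearMap.single Q Z.obj i)
    (LinearMap.ext fun x => ?_) (LinearMap.ext fun x => ?_), fun i x => ?_⟩
  · change F (Pi.single i (F.symm (Pi.single i x) i)) i = x
    rw [← h2, LinearEquiv.apply_symm_apply, Pi.single_eq_same]
  · change F.symm (Pi.single i (F (Pi.single i x) i)) i = x
    rw [← h1, LinearEquiv.symm_apply_apply, Pi.single_eq_same]
  · change F (Pi.single i (X.φ i x)) i = Z.φ i (F (Pi.single (i + 1) x) (i + 1))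
    rw [← totalMap_single, hφ, totalMap_apply]

/-- The total module of an iterated shift is that of `X`, with the grading shifted. -/
theorem exists_shift_equiv {ζ : k} (X : MatFac Q d f) (hζ : IsPrimitiveRoot ζ d) (i : ℕ) :
    ∃ F : (∀ j, X.obj j) ≃ₗ[Q] ∀ j, (shift^[i] X).obj j,
      (∀ u, F (totalMap X.φ u) = totalMap (shift^[i] X).φ (F u)) ∧
      ∀ u, F (totalGrad ζ X u) = algebraMap k Q (ζ ^ i) • totalGrad ζ (shift^[i] X) (F u) := by
  induction i generalizing X with
  | zero => exact ⟨LinearEquiv.refl _ _, fun u => rfl,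
      fun u => by rw [pow_zero, map_one, one_smul]; rfl⟩
  | succ i ih =>
    obtain ⟨F, h1, h2⟩ := ih X.shift
    let F₁ : (∀ j, X.obj j) ≃ₗ[Q] ∀ j, X.shift.obj j :=
      (LinearEquiv.piCongrLeft Q X.obj (Equiv.addRight (1 : ZMod d))).symm
    have hF₁ : ∀ u j, F₁ u j = u (j + 1) := fun u j => rfl
    have hφ : ∀ u, F₁ (totalMap X.φ u) = totalMap X.shift.φ (F₁ u) := fun u => rfl
    have hg : ∀ u, F₁ (totalGrad ζ X u) = algebraMap k Q ζ • totalGrad ζ X.shift (F₁ u) := by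
      intro u
      funext j
      rw [Pi.smul_apply, totalGrad_apply, hF₁, hF₁, totalGrad_apply,
        zeta_pow_val_add_one hζ.pow_eq_one, map_mul, mul_smul]
      rfl
    rw [Function.iterate_succ_apply]
    refine ⟨F₁.trans F, fun u => ?_, fun u => ?_⟩
    · rw [LinearEquiv.trans_apply, hφ, h1, LinearEquiv.trans_apply]
    · rw [LinearEquiv.trans_apply, hg, map_smul, h2, LinearEquiv.trans_apply, smul_smul, ← map_mul,
        pow_succ']

end Total

section Idempotent

variable {Q : Type u} [CommRing Q] {d : ℕ} {f : Q}

/-- The image of an idempotent endomorphism of a matrix factorization. -/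
def ofIdempotent (X : MatFac Q d f) (p : ∀ i, Module.End Q (X.obj i))
    (hp : ∀ i, IsIdempotentElem (p i)) (hφ : ∀ i x, p i (X.φ i x) = X.φ i (p (i + 1) x)) :
    MatFac Q d f where
  obj i := LinearMap.range (p i)
  projective i := Module.Projective.of_split (LinearMap.range (p i)).subtype (p i).rangeRestrict
    (LinearMap.ext fun x => by
      obtain ⟨_, x, rfl⟩ := x
      exact Subtype.ext (LinearMap.congr_fun (hp i).eq x))
  φ i := (X.φ i).restrict (by
    rintro _ ⟨x, rfl⟩
    exact ⟨X.φ i x, hφ i x⟩)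
  pow_eq := by
    refine LinearMap.ext fun w => ?_
    rw [Module.End.coe_pow]
    have := pow_intertwine
      (totalMap (M := fun i => LinearMap.range (p i)) fun i => (X.φ i).restrict (by
        rintro _ ⟨x, rfl⟩
        exact ⟨X.φ i x, hφ i x⟩)) (totalMap X.φ)
      (fun (w : ∀ i, LinearMap.range (p i)) i => (w i : X.obj i)) (fun w => rfl) d w
    rw [X.iterate_eq] at this
    funext i
    exact Subtype.ext (congrFun this i).symm

theorem isomorphic_prod_ofIdempotent (X : MatFac Q d f) (p : ∀ i, Module.End Q (X.obj i))
    (hp : ∀ i, IsIdempotentElem (p i)) (hφ : ∀ i x, p i (X.φ i x) = X.φ i (p (i + 1) x)) :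
    X.Isomorphic ((X.ofIdempotent p hp hφ).prod (X.ofIdempotent (fun i => 1 - p i)
      (fun i => (hp i).one_sub) fun i x => by simp [hφ])) := by
  have hpp : ∀ i x, p i (p i x) = p i x := fun i x => LinearMap.congr_fun (hp i).eq x
  refine ⟨fun i => LinearEquiv.ofLinearMap ((p i).rangeRestrict.prod (1 - p i).rangeRestrict)
    ((LinearMap.range (p i)).subtype.coprod (LinearMap.range (1 - p i)).subtype)
    (LinearMap.ext ?_) (LinearMap.ext fun x => ?_), fun i x => ?_⟩
  · rintro ⟨⟨_, x, rfl⟩, ⟨_, y, rfl⟩⟩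
    refine Prod.ext (Subtype.ext ?_) (Subtype.ext ?_)
    · change p i (p i x + (y - p i y)) = p i x
      rw [map_add, map_sub, hpp, hpp, sub_self, add_zero]
    · change (p i x + (y - p i y)) - p i (p i x + (y - p i y)) = y - p i y
      rw [map_add, map_sub, hpp, hpp, sub_self, add_zero, add_sub_cancel_left]
  · change p i x + (x - p i x) = x
    abel
  · refine Prod.ext (Subtype.ext ?_) (Subtype.ext ?_)
    · exact hφ i x
    · change X.φ i x - p i (X.φ i x) = X.φ i (x - p (i + 1) x)
      rw [hφ, map_sub]

/-- The idempotent endomorphisms of an indecomposable matrix factorization are trivial. -/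
theorem Indecomposable.idempotent_trivial {X : MatFac Q d f} (hX : X.Indecomposable)
    (p : ∀ i, Module.End Q (X.obj i)) (hp : ∀ i, IsIdempotentElem (p i))
    (hφ : ∀ i x, p i (X.φ i x) = X.φ i (p (i + 1) x)) : (∀ i, p i = 0) ∨ ∀ i, p i = 1 := by
  have hz : ∀ q (hq : ∀ i, IsIdempotentElem (q i)) hφ', (X.ofIdempotent q hq hφ').IsZero →
      ∀ i, q i = 0 := by
    intro q hq hφ' h i
    have : Subsingleton (LinearMap.range (q i)) := h i
    refine LinearMap.ext fun x => ?_
    exact congrArg Subtype.val (Subsingleton.elim (⟨q i x, x, rfl⟩ : LinearMap.range (q i)) 0)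
  rcases hX.2 _ _ (X.isomorphic_prod_ofIdempotent p hp hφ) with h | h
  · exact Or.inl (hz _ _ _ h)
  · refine Or.inr fun i => ?_
    exact (sub_eq_zero.1 (hz _ _ _ h i)).symm

end Idempotent

/-! ### Matrices of matrix factorizations -/

section Matrices

variable {Q : Type u} [CommRing Q] {d : ℕ} [NeZero d] {f : Q} {ι : Type*} [Fintype ι]
  [DecidableEq ι]

/-- The basis of the total module obtained from bases of the homogeneous pieces. -/
def totalBasis {X : MatFac Q d f} (b : ∀ i, Module.Basis ι Q (X.obj i)) :
    Module.Basis (ZMod d × ι) Q (∀ i, X.obj i) :=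
  (Pi.basis b).reindex (Equiv.sigmaEquivProd _ _)

omit [Fintype ι] [DecidableEq ι] in
theorem totalBasis_repr {X : MatFac Q d f} (b : ∀ i, Module.Basis ι Q (X.obj i))
    (u : ∀ i, X.obj i) (p : ZMod d × ι) : (totalBasis b).repr u p = (b p.1).repr (u p.1) p.2 := by
  rw [totalBasis, Module.Basis.repr_reindex_apply, Pi.basis_repr]
  rfl

omit [Fintype ι] [DecidableEq ι] in
theorem totalBasis_apply {X : MatFac Q d f} (b : ∀ i, Module.Basis ι Q (X.obj i))
    (p : ZMod d × ι) : totalBasis b p = Pi.single p.1 (b p.1 p.2) := by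
  rw [totalBasis, Module.Basis.reindex_apply, Pi.basis_apply]
  rfl

/-- The matrix of the structure map on the total module. -/
def totalMatrix {X : MatFac Q d f} (b : ∀ i, Module.Basis ι Q (X.obj i)) :
    Matrix (ZMod d × ι) (ZMod d × ι) Q :=
  LinearMap.toMatrixAlgEquiv (totalBasis b) (totalMap X.φ)

theorem totalMatrix_apply {X : MatFac Q d f} (b : ∀ i, Module.Basis ι Q (X.obj i))
    (p q : ZMod d × ι) :
    totalMatrix b p q = (totalBasis b).repr (totalMap X.φ (totalBasis b q)) p := by
  rw [totalMatrix, LinearMap.toMatrixAlgEquiv_apply]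

theorem totalMatrix_eq_zero {X : MatFac Q d f} (b : ∀ i, Module.Basis ι Q (X.obj i))
    (p q : ZMod d × ι) (h : q.1 ≠ p.1 + 1) : totalMatrix b p q = 0 := by
  rw [totalMatrix_apply, totalBasis_repr, totalMap_apply, totalBasis_apply,
    Pi.single_eq_of_ne h.symm, map_zero, map_zero, Finsupp.zero_apply]

theorem totalMatrix_mem {X : MatFac Q d f} [IsLocalRing Q] (hX : X.IsReduced)
    (b : ∀ i, Module.Basis ι Q (X.obj i)) (p q : ZMod d × ι) :
    totalMatrix b p q ∈ IsLocalRing.maximalIdeal Q := by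
  rw [totalMatrix_apply, totalBasis_repr, totalMap_apply]
  have h := hX p.1 ⟨totalBasis b q (p.1 + 1), rfl⟩
  generalize X.φ p.1 (totalBasis b q (p.1 + 1)) = y at h
  refine Submodule.smul_induction_on h (fun r hr x _ => ?_) fun x y hx hy => ?_
  · rw [map_smul, Finsupp.smul_apply, smul_eq_mul]
    exact Ideal.mul_mem_right _ _ hr
  · rw [map_add, Finsupp.add_apply]
    exact add_mem hx hy

variable {k : Type*} [Field k] [Algebra k Q]

theorem toMatrix_totalGrad (ζ : k) {X : MatFac Q d f} (b : ∀ i, Module.Basis ι Q (X.obj i)) :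
    LinearMap.toMatrixAlgEquiv (totalBasis b) (totalGrad ζ X) = gradMatrix Q ζ ι := by
  ext p q
  rw [LinearMap.toMatrixAlgEquiv_apply, totalBasis_apply, totalGrad_single, ← totalBasis_apply,
    map_smul, Module.Basis.repr_self, Finsupp.smul_apply, gradMatrix, Matrix.diagonal_apply,
    Finsupp.single_apply, smul_eq_mul]
  by_cases h : q = p
  · simp [h]
  · simp [h, Ne.symm h]

theorem zeta_pow_val_add {ζ : k} (hζ : ζ ^ d = 1) (i j : ZMod d) :
    ζ ^ (i + j).val = ζ ^ i.val * ζ ^ j.val := by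
  rw [ZMod.val_add, ← pow_add, ← pow_mod_orderOf, ← pow_mod_orderOf ζ (i.val + j.val),
    Nat.mod_mod_of_dvd _ (orderOf_dvd_of_pow_eq_one hζ)]

/-- An indecomposable matrix factorization over a complete local ring which is not isomorphic to its
nontrivial shifts is rigid and local. -/
theorem Indecomposable.isRigidLocal {ζ : k} (hζ : IsPrimitiveRoot ζ d) (ε : Q →ₐ[k] k)
    [IsLocalHom ε] (I : Ideal Q) [IsAdicComplete I Q] (hI : ∀ r, ε r = 0 ↔ r ∈ I)
    {X : MatFac Q d f} (hX : X.Indecomposable)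
    (hXT : ∀ i : ℕ, 0 < i → i < d → ¬ X.Isomorphic (shift^[i] X))
    (b : ∀ i, Module.Basis ι Q (X.obj i)) : IsRigidLocal ζ (totalMatrix b) where
  isUnit_or u hu := by
    obtain ⟨hu1, hu2⟩ := mem_gradedCommutant.1 hu
    refine isUnit_or_isUnit_one_sub_of_trivial_idempotents ε I hI u fun e he hcomm => ?_
    let M := LinearMap.toMatrixAlgEquiv (totalBasis b)
    set F := M.symm e with hF
    have hMF : M F = e := M.apply_symm_apply e
    have hFφ : ∀ w, F (totalMap X.φ w) = totalMap X.φ (F w) := fun w => by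
      have : F * totalMap X.φ = totalMap X.φ * F := M.injective (by
        rw [map_mul, map_mul, hMF]; exact (hcomm _ hu1.symm).eq.symm)
      exact LinearMap.congr_fun this w
    have hFg : ∀ w, F (totalGrad ζ X w) = totalGrad ζ X (F w) := fun w => by
      have : F * totalGrad ζ X = totalGrad ζ X * F := M.injective (by
        rw [map_mul, map_mul, hMF, toMatrix_totalGrad]; exact (hcomm _ hu2.symm).eq.symm)
      exact LinearMap.congr_fun this w
    have hFF : ∀ w, F (F w) = F w := fun w => by
      have : F * F = F := M.injective (by rw [map_mul, hMF]; exact he.eq)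
      exact LinearMap.congr_fun this w
    have hs := apply_single_of_commutes hζ hFg
    let p : ∀ i, Module.End Q (X.obj i) := fun i =>
      LinearMap.proj i ∘ₗ F ∘ₗ LinearMap.single Q X.obj i
    have hp : ∀ i x, p i x = F (Pi.single i x) i := fun i x => rfl
    have hF_ext : ∀ G : Module.End Q (∀ i, X.obj i),
        (∀ i x, F (Pi.single i x) = G (Pi.single i x)) → F = G := fun G h => LinearMap.pi_ext h
    rcases hX.idempotent_trivial p (fun i => LinearMap.ext fun x => by
        rw [Module.End.mul_apply, hp, hp, ← hs, hFF]) (fun i x => by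
        rw [hp, hp, ← totalMap_single, hFφ, totalMap_apply]) with h | h
    · left
      have : F = 0 := hF_ext 0 fun i x => by
        rw [hs, ← hp, h]; simp
      rw [← hMF, this, map_zero]
    · right
      have : F = 1 := hF_ext 1 fun i x => by
        rw [hs, ← hp, h]; rfl
      rw [← hMF, this, map_one]
  not_isUnit j j' hj U hU hgU hunit := by
    have hs0 : 0 < (j' - j).val := by
      rw [ZMod.val_pos]
      exact sub_ne_zero.2 hj.symm
    refine hXT _ hs0 (ZMod.val_lt _) ?_
    obtain ⟨Fs, hs1, hs2⟩ := exists_shift_equiv X hζ (j' - j).val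
    let M := LinearMap.toMatrixAlgEquiv (totalBasis b)
    set L := M.symm U with hL
    have hML : M L = U := M.apply_symm_apply U
    have hLunit : IsUnit L := hunit.map M.symm
    let L' : (∀ i, X.obj i) ≃ₗ[Q] ∀ i, X.obj i :=
      LinearEquiv.ofBijective L ((Module.End.isUnit_iff L).1 hLunit)
    have hLφ : ∀ w, L (totalMap X.φ w) = totalMap X.φ (L w) := fun w => by
      have : L * totalMap X.φ = totalMap X.φ * L := M.injective (by
        rw [map_mul, map_mul, hML]; exact hU.eq)
      exact LinearMap.congr_fun this w
    have hLg : ∀ w, algebraMap k Q (ζ ^ j.val) • totalGrad ζ X (L w) =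
        algebraMap k Q (ζ ^ j'.val) • L (totalGrad ζ X w) := fun w => by
      have : algebraMap k Q (ζ ^ j.val) • (totalGrad ζ X * L) =
          algebraMap k Q (ζ ^ j'.val) • (L * totalGrad ζ X) := M.injective (by
        rw [map_smul, map_smul, map_mul, map_mul, hML, toMatrix_totalGrad, algebraMap_smul,
          algebraMap_smul]
        exact hgU)
      exact LinearMap.congr_fun this w
    refine isomorphic_of_total hζ (L'.trans Fs) (fun w => ?_) fun w => ?_
    · change Fs (L _) = _
      rw [hLφ, hs1]
      rfl
    · change Fs (L _) = totalGrad ζ _ (Fs (L w))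
      have hu : IsUnit (algebraMap k Q (ζ ^ j'.val)) :=
        (IsUnit.mk0 _ (pow_ne_zero _ (hζ.ne_zero (NeZero.ne d)))).map _
      rw [← hu.smul_left_cancel, ← map_smul, ← hLg, map_smul, hs2, smul_smul, ← map_mul, ← pow_add,
        pow_add, ← zeta_pow_val_add hζ.pow_eq_one, add_sub_cancel]

end Matrices

/-! ### Matrices of base changes and tensor products -/

section BaseChange

variable {Q Q' : Type u} [CommRing Q] [CommRing Q'] {d : ℕ} [NeZero d] {f : Q} {ι : Type*}
  [Fintype ι] [DecidableEq ι]

/-- The bases of the base change of `X` induced by bases of `X`. -/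
def baseChangeBasis (ρ : Q →+* Q') {X : MatFac Q d f} (b : ∀ i, Module.Basis ι Q (X.obj i))
    (i : ZMod d) : Module.Basis ι Q' ((X.baseChange ρ).obj i) :=
  letI := ρ.toAlgebra
  Algebra.TensorProduct.basis Q' (b i)

theorem totalMatrix_baseChange (ρ : Q →+* Q') {X : MatFac Q d f}
    (b : ∀ i, Module.Basis ι Q (X.obj i)) :
    totalMatrix (baseChangeBasis ρ b) = (totalMatrix b).map ρ := by
  let _ := ρ.toAlgebra
  let T : (∀ i, X.obj i) → ∀ i, (X.baseChange ρ).obj i := fun u i => (1 : Q') ⊗ₜ[Q] u i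
  have hrepr : ∀ u p, (totalBasis (baseChangeBasis ρ b)).repr (T u) p =
      ρ ((totalBasis b).repr u p) := fun u p => by
    rw [totalBasis_repr, totalBasis_repr]
    refine (Algebra.TensorProduct.basis_repr_tmul (b p.1) (1 : Q') (u p.1) ▸ rfl : _ =
      ((1 : Q') • Finsupp.mapRange (algebraMap Q Q') (map_zero _)
        ((b p.1).repr (u p.1))) p.2).trans ?_
    rw [one_smul]
    rfl
  have hT : ∀ q, totalBasis (baseChangeBasis ρ b) q = T (totalBasis b q) := fun q => by
    apply (totalBasis (baseChangeBasis ρ b)).repr.injective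
    ext p
    rw [hrepr, Module.Basis.repr_self, Module.Basis.repr_self, Finsupp.single_apply,
      Finsupp.single_apply]
    split_ifs <;> simp
  have hφ : ∀ u, totalMap (X.baseChange ρ).φ (T u) = T (totalMap X.φ u) := fun u => rfl
  ext p q
  rw [totalMatrix_apply, hT, hφ, hrepr, Matrix.map_apply, totalMatrix_apply]

end BaseChange

section TensorBasis

variable {k : Type*} [Field k] {Q : Type u} [CommRing Q] [Algebra k Q] {d : ℕ} [NeZero d]
  {f g : Q} {X : MatFac Q d f} {Y : MatFac Q d g} {ι κ : Type*} [Fintype ι] [DecidableEq ι]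
  [Fintype κ] [DecidableEq κ]

variable (d ι κ) in
/-- Pairs of homogeneous basis vectors, sorted by their total degree. -/
def tensorIndexEquiv : (Σ k : ZMod d, Σ _ : {p : ZMod d × ZMod d // p.1 + p.2 = k}, ι × κ) ≃
    (ZMod d × ι) × (ZMod d × κ) where
  toFun x := ((x.2.1.1.1, x.2.2.1), (x.2.1.1.2, x.2.2.2))
  invFun x := ⟨x.1.1 + x.2.1, ⟨(x.1.1, x.2.1), rfl⟩, (x.1.2, x.2.2)⟩
  left_inv := by
    rintro ⟨k, ⟨⟨i, j⟩, rfl⟩, a, b⟩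
    rfl
  right_inv _ := rfl

variable (ζ : k) (hζ : IsPrimitiveRoot ζ d)

/-- The basis of the total module of a tensor product given by the tensor products of basis
vectors. -/
def tensorBasis (bX : ∀ i, Module.Basis ι Q (X.obj i)) (bY : ∀ j, Module.Basis κ Q (Y.obj j)) :
    Module.Basis ((ZMod d × ι) × (ZMod d × κ)) Q (∀ i, (tensor ζ hζ X Y).obj i) :=
  (Pi.basis fun k => Pi.basis fun p : {p : ZMod d × ZMod d // p.1 + p.2 = k} =>
    (bX p.1.1).tensorProduct (bY p.1.2)).reindex (tensorIndexEquiv d ι κ)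

/-- The tensor product of two elements of the total modules, as an element of the total module of
the tensor product of matrix factorizations. -/
def pureTensor (u : ∀ i, X.obj i) (v : ∀ j, Y.obj j) : ∀ i, (tensor ζ hζ X Y).obj i :=
  tensorElt u v

variable (bX : ∀ i, Module.Basis ι Q (X.obj i)) (bY : ∀ j, Module.Basis κ Q (Y.obj j))

omit [Fintype ι] [DecidableEq ι] [Fintype κ] [DecidableEq κ] in
theorem tensorBasis_repr (u : ∀ i, X.obj i) (v : ∀ j, Y.obj j)
    (x : (ZMod d × ι) × (ZMod d × κ)) :
    (tensorBasis ζ hζ bX bY).repr (pureTensor ζ hζ u v) x =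
      (totalBasis bX).repr u x.1 * (totalBasis bY).repr v x.2 := by
  rw [totalBasis_repr, totalBasis_repr, mul_comm]
  exact Module.Basis.tensorProduct_repr_tmul_apply (bX x.1.1) (bY x.2.1) (u x.1.1) (v x.2.1)
    x.1.2 x.2.2

omit [Fintype ι] [Fintype κ] in
theorem tensorBasis_apply (x : (ZMod d × ι) × (ZMod d × κ)) :
    tensorBasis ζ hζ bX bY x = pureTensor ζ hζ (totalBasis bX x.1) (totalBasis bY x.2) := by
  apply (tensorBasis ζ hζ bX bY).repr.injective
  ext y
  rw [tensorBasis_repr, Module.Basis.repr_self, Module.Basis.repr_self, Module.Basis.repr_self,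
    Finsupp.single_apply, Finsupp.single_apply, Finsupp.single_apply]
  by_cases h1 : x.1 = y.1 <;> by_cases h2 : x.2 = y.2 <;> simp [Prod.ext_iff, h1, h2]

theorem toMatrix_tensor_totalMap :
    LinearMap.toMatrixAlgEquiv (tensorBasis ζ hζ bX bY) (totalMap (tensor ζ hζ X Y).φ) =
      totalMatrix bX ⊗ₖ (1 : Matrix (ZMod d × κ) (ZMod d × κ) Q) +
        gradMatrix Q ζ ι ⊗ₖ totalMatrix bY := by
  have h : ∀ u v, totalMap (tensor ζ hζ X Y).φ (pureTensor ζ hζ u v) =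
      pureTensor ζ hζ (totalMap X.φ u) v +
        pureTensor ζ hζ (totalGrad ζ X u) (totalMap Y.φ v) := by
    intro u v
    funext i
    have h' : tensorRight ζ X Y i (tensorElt u v (i + 1)) =
        tensorElt (totalGrad ζ X u) (totalMap Y.φ v) i := by
      funext p
      exact TensorProduct.smul_tmul' _ _ _
    exact congrArg (tensorElt (totalMap X.φ u) v i + ·) h'
  ext x y
  rw [LinearMap.toMatrixAlgEquiv_apply, tensorBasis_apply, h, map_add, Finsupp.add_apply,
    tensorBasis_repr, tensorBasis_repr, Matrix.add_apply, Matrix.kronecker_apply,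
    Matrix.kronecker_apply, ← totalMatrix_apply, ← totalMatrix_apply, ← toMatrix_totalGrad ζ bX,
    LinearMap.toMatrixAlgEquiv_apply, Module.Basis.repr_self, Finsupp.single_apply,
    Matrix.one_apply]
  simp only [eq_comm]

theorem toMatrix_tensor_totalGrad :
    LinearMap.toMatrixAlgEquiv (tensorBasis ζ hζ bX bY) (totalGrad ζ (tensor ζ hζ X Y)) =
      gradMatrix Q ζ ι ⊗ₖ gradMatrix Q ζ κ := by
  have h : ∀ u v, totalGrad ζ (tensor ζ hζ X Y) (pureTensor ζ hζ u v) =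
      pureTensor ζ hζ (totalGrad ζ X u) (totalGrad ζ Y v) := by
    intro u v
    funext i
    refine funext fun (p : {p : ZMod d × ZMod d // p.1 + p.2 = i}) => ?_
    change algebraMap _ Q (ζ ^ i.val) • (u p.1.1 ⊗ₜ[Q] v p.1.2) =
      (algebraMap _ Q (ζ ^ p.1.1.val) • u p.1.1) ⊗ₜ[Q] (algebraMap _ Q (ζ ^ p.1.2.val) • v p.1.2)
    rw [TensorProduct.smul_tmul_smul, ← map_mul, ← zeta_pow_val_add hζ.pow_eq_one, p.2]
  ext x y
  rw [LinearMap.toMatrixAlgEquiv_apply, tensorBasis_apply, h, tensorBasis_repr,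
    Matrix.kronecker_apply, ← toMatrix_totalGrad ζ bX, ← toMatrix_totalGrad ζ bY,
    LinearMap.toMatrixAlgEquiv_apply, LinearMap.toMatrixAlgEquiv_apply]

end TensorBasis

/-! ### Decompositions -/

section Decomposition

variable {Q : Type u} [CommRing Q] {d : ℕ} {f : Q}

/-- The endomorphism of the total module with the given homogeneous components. -/
def totalEnd {X : MatFac Q d f} (p : ∀ i, Module.End Q (X.obj i)) : Module.End Q (∀ i, X.obj i) :=
  LinearMap.pi fun i => p i ∘ₗ LinearMap.proj i

theorem totalEnd_apply {X : MatFac Q d f} (p : ∀ i, Module.End Q (X.obj i)) (u : ∀ i, X.obj i)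
    (i : ZMod d) : totalEnd p u i = p i (u i) := rfl

/-- A decomposition into `N` nonzero summands gives `N` nonzero orthogonal idempotent
endomorphisms. -/
theorem exists_idempotents_of_isomorphic_directSum {X : MatFac Q d f} {N : ℕ}
    {Z : Fin N → MatFac Q d f} (hZ : ∀ l, ¬ (Z l).IsZero) (hX : X.Isomorphic (directSum Z)) :
    ∃ E : Fin N → Module.End Q (∀ i, X.obj i), (∀ l, IsIdempotentElem (E l)) ∧
      (∀ l l', l ≠ l' → E l * E l' = 0) ∧ (∀ l, E l ≠ 0) ∧
      (∀ l, Commute (E l) (totalMap X.φ)) ∧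
      ∀ l, ∃ p : ∀ i, Module.End Q (X.obj i), E l = totalEnd p := by
  classical
  obtain ⟨e, he⟩ : ∃ e : ∀ i, X.obj i ≃ₗ[Q] ∀ l, (Z l).obj i,
      ∀ i x l, e i (X.φ i x) l = (Z l).φ i (e (i + 1) x l) :=
    hX.imp fun e he i x l => congrFun (he i x) l
  let s : ∀ l i, Module.End Q (∀ l, (Z l).obj i) := fun l i =>
    LinearMap.single Q (fun l => (Z l).obj i) l ∘ₗ LinearMap.proj l
  let p : ∀ (_ : Fin N) i, Module.End Q (X.obj i) := fun l i =>
    (e i).symm.toLinearMap ∘ₗ s l i ∘ₗ (e i).toLinearMap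
  have hp : ∀ l i x, e i (p l i x) = Pi.single l (e i x l) := fun l i x =>
    (e i).apply_symm_apply _
  have hpφ : ∀ l i x, p l i (X.φ i x) = X.φ i (p l (i + 1) x) := fun l i x => by
    apply (e i).injective
    funext l'
    rw [hp, he, he, hp]
    by_cases h : l' = l
    · subst h; simp
    · rw [Pi.single_eq_of_ne h, Pi.single_eq_of_ne h, map_zero]
  refine ⟨fun l => totalEnd (p l), fun l => ?_, fun l l' hl => ?_, fun l h => hZ l fun i => ?_,
    fun l => ?_, fun l => ⟨p l, rfl⟩⟩
  · refine LinearMap.ext fun u => funext fun i => (e i).injective ?_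
    change e i (p l i (p l i (u i))) = e i (p l i (u i))
    rw [hp, hp, Pi.single_eq_same]
  · refine LinearMap.ext fun u => funext fun i => (e i).injective ?_
    change e i (p l i (p l' i (u i))) = e i 0
    rw [hp, hp, Pi.single_eq_of_ne hl, Pi.single_zero, map_zero]
  · refine subsingleton_of_forall_eq 0 fun z => ?_
    have h1 := congrFun (LinearMap.congr_fun h
      (Pi.single i ((e i).symm (Pi.single l z)))) i
    rw [totalEnd_apply, Pi.single_eq_same] at h1
    have h2 := hp l i ((e i).symm (Pi.single l z))
    rw [h1, LinearEquiv.apply_symm_apply, Pi.single_eq_same, LinearMap.zero_apply, Pi.zero_apply,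
      map_zero] at h2
    have h3 := congrFun h2 l
    rwa [Pi.single_eq_same, Pi.zero_apply, eq_comm] at h3
  · refine LinearMap.ext fun u => funext fun i => ?_
    exact hpφ l i (u (i + 1))

theorem commute_totalEnd_totalGrad {k : Type*} [Field k] [Algebra k Q] (ζ : k) {X : MatFac Q d f}
    (p : ∀ i, Module.End Q (X.obj i)) : Commute (totalEnd p) (totalGrad ζ X) := by
  refine LinearMap.ext fun u => funext fun i => ?_
  exact map_smul (p i) _ _

theorem Isomorphic.trans {X Y Z : MatFac Q d f} (h : X.Isomorphic Y) (h' : Y.Isomorphic Z) :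
    X.Isomorphic Z := by
  obtain ⟨e, he⟩ := h
  obtain ⟨e', he'⟩ := h'
  exact ⟨fun i => (e i).trans (e' i), fun i x => by simp [he, he']⟩

theorem Isomorphic.prod_directSum {X A B : MatFac Q d f} {N M : ℕ} {Z : Fin N → MatFac Q d f}
    {W : Fin M → MatFac Q d f} (h : X.Isomorphic (A.prod B)) (hA : A.Isomorphic (directSum Z))
    (hB : B.Isomorphic (directSum W)) : X.Isomorphic (directSum (Fin.append Z W)) := by
  obtain ⟨e, he⟩ := h
  obtain ⟨eA, heA⟩ := hA
  obtain ⟨eB, heB⟩ := hB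
  have hcast : ∀ (l : Fin N ⊕ Fin M), Fin.append Z W (finSumFinEquiv l) = Sum.elim Z W l := by
    rintro (l | l) <;> simp
  have hiso : (directSum (fun l : Fin N ⊕ Fin M => Sum.elim Z W l)).Isomorphic
      (directSum (Fin.append Z W)) := by
    have h1 : (directSum (fun l : Fin N ⊕ Fin M => Fin.append Z W (finSumFinEquiv l))).Isomorphic
        (directSum (Fin.append Z W)) :=
      ⟨fun i => LinearEquiv.piCongrLeft Q (fun l => (Fin.append Z W l).obj i) finSumFinEquiv,
        fun i x => by
          funext l
          obtain ⟨l, rfl⟩ := finSumFinEquiv.surjective l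
          exact (Equiv.piCongrLeft_apply_apply (fun l => (Fin.append Z W l).obj i)
            finSumFinEquiv _ l).trans (congrArg ((Fin.append Z W (finSumFinEquiv l)).φ i)
              (Equiv.piCongrLeft_apply_apply (fun l => (Fin.append Z W l).obj (i + 1))
                finSumFinEquiv x l).symm)⟩
    rwa [funext hcast] at h1
  have hsum : (A.prod B).Isomorphic (directSum (fun l : Fin N ⊕ Fin M => Sum.elim Z W l)) := by
    refine ⟨fun i => ((eA i).prodCongr (eB i)).trans
      (LinearEquiv.sumPiEquivProdPi Q (Fin N) (Fin M) (fun l => (Sum.elim Z W l).obj i)).symm,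
      fun i x => ?_⟩
    funext l
    rcases l with l | l
    · exact congrFun (heA i x.1) l
    · exact congrFun (heB i x.2) l
  exact (Isomorphic.trans ⟨e, he⟩ hsum).trans hiso

/-- Every matrix factorization over a local ring is a finite direct sum of indecomposable ones, by
induction on the rank of the total module. -/
theorem exists_isSumOfIndecomposables [IsLocalRing Q] [NeZero d] (X : MatFac Q d f) :
    ∃ N, X.IsSumOfIndecomposables N := by
  obtain ⟨r, hr⟩ : ∃ r, ∑ i, Module.finrank Q (X.obj i) = r := ⟨_, rfl⟩
  induction r using Nat.strong_induction_on generalizing X with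
  | _ r ih =>
    have hfree : ∀ (Z : MatFac Q d f) i, Module.Free Q (Z.obj i) := fun Z i =>
      Module.free_of_flat_of_isLocalRing
    by_cases h0 : X.IsZero
    · refine ⟨0, Fin.elim0, fun i => i.elim0, fun i => ?_, fun i x =>
        Subsingleton.elim (α := ∀ l : Fin 0, _) _ _⟩
      have := h0 i
      have : Subsingleton ((directSum (Fin.elim0 : Fin 0 → MatFac Q d f)).obj i) :=
        inferInstanceAs (Subsingleton (∀ l : Fin 0, _))
      exact 0
    · by_cases hind : X.Indecomposable
      · refine ⟨1, fun _ => X, fun _ => hind, fun i => ?_, fun i x => ?_⟩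
        · exact (LinearEquiv.funUnique (Fin 1) Q (X.obj i)).symm
        · rfl
      · rw [Indecomposable] at hind
        push Not at hind
        obtain ⟨A, B, hAB, hA, hB⟩ := hind h0
        have hpos : ∀ Z : MatFac Q d f, ¬ Z.IsZero → 0 < ∑ i, Module.finrank Q (Z.obj i) := by
          intro Z hZ
          by_contra hle
          refine hZ fun i => ?_
          have hz : Module.finrank Q (Z.obj i) = 0 :=
            Finset.sum_eq_zero_iff.1 (Nat.le_zero.1 (not_lt.1 hle)) i (Finset.mem_univ i)
          have := hfree Z i
          exact (Module.finrank_eq_zero_iff_of_free _ _).1 hz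
        have hsum : ∑ i, Module.finrank Q (A.obj i) + ∑ i, Module.finrank Q (B.obj i) = r := by
          rw [← hr, ← Finset.sum_add_distrib]
          refine Finset.sum_congr rfl fun i _ => ?_
          have := hfree A i
          have := hfree B i
          obtain ⟨e, -⟩ := hAB
          rw [(e i).finrank_eq]
          exact (Module.finrank_prod (R := Q) (M := A.obj i) (M' := B.obj i)).symm
        have hA0 := hpos A hA
        have hB0 := hpos B hB
        obtain ⟨N, Z, hZ, hAZ⟩ := ih _ (by omega) A rfl
        obtain ⟨M, W, hW, hBW⟩ := ih _ (by omega) B rfl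
        refine ⟨N + M, Fin.append Z W, fun l => ?_, hAB.prod_directSum hAZ hBW⟩
        induction l using Fin.addCases with
        | left l => rw [Fin.append_left]; exact hZ l
        | right l => rw [Fin.append_right]; exact hW l

end Decomposition

end MatFac

/-! ### Specialization of power series -/

namespace MvPowerSeries

/-- Setting to zero all variables outside the range of `e` sends a power series in some of these
variables to its constant term; here this term is zero. -/
theorem killCompl_rename_eq_zero {σ τ k : Type*} [CommRing k] {n : ℕ} (e : σ ↪ τ) (e' : Fin n ↪ τ)
    (he : ∀ i, e' i ∉ Set.range e) {p : MvPowerSeries (Fin n) k} (hp : constantCoeff p = 0) :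
    killCompl e (rename e' p) = 0 := by
  have h : Ideal.span (Set.range X) ≤
      RingHom.ker ((killCompl e).comp (rename (R := k) e') : MvPowerSeries (Fin n) k →ₐ[k] _) := by
    rw [Ideal.span_le]
    rintro _ ⟨i, rfl⟩
    change killCompl e (rename e' (X i)) = 0
    rw [rename_X, killCompl_X_eq_zero (he i)]
  exact h (mem_span_range_X_of_constantCoeff_eq_zero p hp)

theorem constantCoeff_killCompl {σ τ k : Type*} [CommRing k] (e : σ ↪ τ) (p : MvPowerSeries τ k) :
    constantCoeff (killCompl e p) = constantCoeff p := by
  rw [← coeff_zero_eq_constantCoeff_apply, coeff_killCompl, Finsupp.embDomain_zero,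
    coeff_zero_eq_constantCoeff_apply]

/-- The constant coefficient, as the residue homomorphism of `k`-algebras. -/
def constantCoeffAlgHom (σ k : Type*) [CommRing k] : MvPowerSeries σ k →ₐ[k] k :=
  { constantCoeff with commutes' := fun r => constantCoeff_C r }

instance {σ k : Type*} [CommRing k] : IsLocalHom (constantCoeffAlgHom σ k) :=
  ⟨fun _ h => isUnit_iff_constantCoeff.2 h⟩

theorem constantCoeffAlgHom_eq_zero_iff {k : Type*} [CommRing k] {n : ℕ}
    (p : MvPowerSeries (Fin n) k) :
    constantCoeffAlgHom (Fin n) k p = 0 ↔ p ∈ Ideal.span (Set.range X) := by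
  refine ⟨mem_span_range_X_of_constantCoeff_eq_zero p, fun h => ?_⟩
  have h' : Ideal.span (Set.range X) ≤ RingHom.ker (constantCoeff (σ := Fin n) (R := k)) := by
    rw [Ideal.span_le]
    rintro _ ⟨i, rfl⟩
    exact constantCoeff_X i
  exact h' h

theorem constantCoeff_eq_zero_of_mem_maximalIdeal {σ k : Type*} [Field k] {p : MvPowerSeries σ k}
    (hp : p ∈ IsLocalRing.maximalIdeal (MvPowerSeries σ k)) : constantCoeff p = 0 := by
  rw [IsLocalRing.mem_maximalIdeal, mem_nonunits_iff, isUnit_iff_constantCoeff, isUnit_iff_ne_zero,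
    not_not] at hp
  exact hp

end MvPowerSeries

namespace MatFac

theorem nonempty_basis {Q : Type u} [CommRing Q] [IsLocalRing Q] {d n : ℕ} {f : Q}
    {X : MatFac Q d f} (hn : X.HasRank n) (i : ZMod d) :
    Nonempty (Module.Basis (Fin n) Q (X.obj i)) := by
  have : Module.Free Q (X.obj i) := Module.free_of_flat_of_isLocalRing
  exact ⟨Module.finBasisOfFinrankEq Q _ (hn i)⟩

theorem HasRank.pos {Q : Type u} [CommRing Q] [IsLocalRing Q] {d n : ℕ} {f : Q}
    {X : MatFac Q d f} (hn : X.HasRank n) (hX : ¬ X.IsZero) : 0 < n := by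
  refine Nat.pos_of_ne_zero fun h => hX fun i => ?_
  have : Module.Free Q (X.obj i) := Module.free_of_flat_of_isLocalRing
  exact (Module.finrank_eq_zero_iff_of_free _ _).1 ((hn i).trans h)

end MatFac

end

open MvPowerSeries Kronecker in
theorem theorem5p3 {𝕜 : Type u} [Field 𝕜] (d : ℕ) [NeZero d] (hd : 2 ≤ d)
    (ζ : 𝕜) (hζ : IsPrimitiveRoot ζ d) (a b : ℕ)
    (f : MvPowerSeries (Fin a) 𝕜) (g : MvPowerSeries (Fin b) 𝕜)
    (hf : f ≠ 0) (hf' : ¬ IsUnit f) (hg : g ≠ 0) (hg' : ¬ IsUnit g)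
    (X : MatFac (MvPowerSeries (Fin a) 𝕜) d f) (Y : MatFac (MvPowerSeries (Fin b) 𝕜) d g)
    (hX : X.Indecomposable) (hXr : X.IsReduced) (hY : Y.Indecomposable) (hYr : Y.IsReduced)
    (n m : ℕ) (hn : X.HasRank n) (hm : Y.HasRank m)
    (hXT : ∀ i : ℕ, 0 < i → i < d → ¬ X.Isomorphic (MatFac.shift^[i] X))
    (hYT : ∀ j : ℕ, 0 < j → j < d → ¬ Y.Isomorphic (MatFac.shift^[j] Y)) :
    (∃ N : ℕ, (MatFac.externalTensor ζ hζ X Y).IsSumOfIndecomposables N) ∧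
      ∀ N : ℕ, (MatFac.externalTensor ζ hζ X Y).IsSumOfIndecomposables N → N ≤ Nat.gcd n m := by
  refine ⟨MatFac.exists_isSumOfIndecomposables _, fun N hN => ?_⟩
  obtain ⟨Z, hZ, hiso⟩ := hN
  have : Nonempty (Fin n) := ⟨⟨0, hn.pos hX.1⟩⟩
  have : Nonempty (Fin m) := ⟨⟨0, hm.pos hY.1⟩⟩
  let bX := fun i => (MatFac.nonempty_basis hn i).some
  let bY := fun j => (MatFac.nonempty_basis hm j).some
  let r₁ : MvPowerSeries (Fin a) 𝕜 →ₐ[𝕜] MvPowerSeries (Fin a ⊕ Fin b) 𝕜 := rename Sum.inl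
  let r₂ : MvPowerSeries (Fin b) 𝕜 →ₐ[𝕜] MvPowerSeries (Fin a ⊕ Fin b) 𝕜 := rename Sum.inr
  let i₁ : Fin a ↪ Fin a ⊕ Fin b := .inl
  let i₂ : Fin b ↪ Fin a ⊕ Fin b := .inr
  -- Setting one group of variables to zero kills the entries of the matrix of the other factor, as
  -- both factors are reduced.
  have hA0 : ∀ p q, killCompl i₂ (r₁ (MatFac.totalMatrix bX p q)) = 0 := fun p q =>
    killCompl_rename_eq_zero i₂ i₁ (by rintro i ⟨j, h⟩; cases h)
      (constantCoeff_eq_zero_of_mem_maximalIdeal (MatFac.totalMatrix_mem hXr bX p q))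
  have hB0 : ∀ p q, killCompl i₁ (r₂ (MatFac.totalMatrix bY p q)) = 0 := fun p q =>
    killCompl_rename_eq_zero i₁ i₂ (by rintro i ⟨j, h⟩; cases h)
      (constantCoeff_eq_zero_of_mem_maximalIdeal (MatFac.totalMatrix_mem hYr bY p q))
  have hA1 : ∀ p, killCompl i₁ (r₁ p) = p := killCompl_rename_app (e := i₁)
  have hB1 : ∀ p, killCompl i₂ (r₂ p) = p := killCompl_rename_app (e := i₂)
  obtain ⟨E, hid, horth, hne, hφ, hE⟩ :=
    MatFac.exists_idempotents_of_isomorphic_directSum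
      (X := MatFac.tensor ζ hζ (X.baseChange r₁.toRingHom) (Y.baseChange r₂.toRingHom))
      (fun l => (hZ l).1) hiso
  let bT := MatFac.tensorBasis ζ hζ (MatFac.baseChangeBasis r₁.toRingHom bX)
    (MatFac.baseChangeBasis r₂.toRingHom bY)
  let M := LinearMap.toMatrixAlgEquiv bT
  have hMφ := MatFac.toMatrix_tensor_totalMap ζ hζ (MatFac.baseChangeBasis r₁.toRingHom bX)
    (MatFac.baseChangeBasis r₂.toRingHom bY)
  have hMg := MatFac.toMatrix_tensor_totalGrad ζ hζ (MatFac.baseChangeBasis r₁.toRingHom bX)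
    (MatFac.baseChangeBasis r₂.toRingHom bY)
  rw [MatFac.totalMatrix_baseChange, MatFac.totalMatrix_baseChange] at hMφ
  have key := card_le_gcd_of_orthogonal_idempotents hζ (killCompl (R := 𝕜) i₁) (killCompl i₂)
    (constantCoeffAlgHom _ _) (constantCoeffAlgHom _ _) (constantCoeffAlgHom _ _)
    (constantCoeff_killCompl i₁) (constantCoeff_killCompl i₂)
    (hX.isRigidLocal hζ (constantCoeffAlgHom _ _) _ constantCoeffAlgHom_eq_zero_iff hXT bX)
    (hY.isRigidLocal hζ (constantCoeffAlgHom _ _) _ constantCoeffAlgHom_eq_zero_iff hYT bY)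
    (MatFac.totalMatrix_eq_zero bY)
    (Φ := (MatFac.totalMatrix bX).map r₁ ⊗ₖ 1 + gradMatrix _ ζ _ ⊗ₖ (MatFac.totalMatrix bY).map r₂)
    (by
      refine Matrix.ext fun p q => ?_
      rw [Matrix.map_apply, Matrix.add_apply, map_add, Matrix.kronecker_apply,
        Matrix.kronecker_apply, map_mul, map_mul, Matrix.map_apply, Matrix.map_apply, hA1, hB0,
        mul_zero, add_zero, Matrix.kronecker_apply, Matrix.one_apply, Matrix.one_apply,
        apply_ite (killCompl i₁), map_one, map_zero])
    (by
      refine Matrix.ext fun p q => ?_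
      rw [Matrix.map_apply, Matrix.add_apply, map_add, Matrix.kronecker_apply,
        Matrix.kronecker_apply, map_mul, map_mul, Matrix.map_apply, Matrix.map_apply, hB1, hA0,
        zero_mul, zero_add, Matrix.kronecker_apply, gradMatrix, gradMatrix, Matrix.diagonal_apply,
        Matrix.diagonal_apply, apply_ite (killCompl i₂), AlgHom.commutes, map_zero])
    (fun l => M (E l))
    (fun l => by
      have := (hφ l).map M
      exact hMφ ▸ this)
    (fun l => by
      obtain ⟨p, hp⟩ := hE l
      have := (MatFac.commute_totalEnd_totalGrad ζ p).map M
      rw [← hp] at this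
      exact hMg ▸ this)
    (fun l => (hid l).map M)
    (fun l l' h => by rw [← map_mul, horth l l' h, map_zero])
    (fun l h => hne l (M.injective (h.trans (map_zero M).symm)))
  simpa using key
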